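/- For a group $G$ and a normal subgroup $N$ of $G$, conjugation makes $N/[N,N]$ a right $\mathbb{Z}[G/N]$-module by $[x]g=[g^{-1}xg]$. The torsion-free derived series of $G$ is defined by $G^{(0)}_H=G$ and $$G^{(n+1)}_H=\{x\in G^{(n)}_H \;:\; [x]\gamma=0 \text{ in } G^{(n)}_H/[G^{(n)}_H,G^{(n)}_H] \text{ for some } 0\neq\gamma\in\mathbb{Z}[G/G^{(n)}_H]\}.$$ (Each $\mathbb{Z}[G/G^{(n)}_H]$ is an Ore domain, so $G^{(n+1)}_H$ is a subgroup, normal in $G$, and $G^{(n)}_H/G^{(n+1)}_H$ is a torsion-free right $\mathbb{Z}[G/G^{(n)}_H]$-module; its rank is the maximal number of linearly independent elements, equivalently the dimension after tensoring with the skew field of quotients.) For a normal subgroup $N$ of $G$ let $\Phi^N(G)$ be the image of $H_2(N;\mathbb{Z})\to H_2(G;\mathbb{Z})$ (the classes represented by $N$-surfaces), and let $\langle\Phi^{(n)}_H(G)\rangle\subset H_2(G;\mathbb{Q})$ be the rational subspace spanned by the image of $\Phi^{N}(G)$ for $N=G^{(n)}_H$. A group is finitely related if it has a presentation with finitely many relators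 (and arbitrarily many generators). **Theorem.** Let $A$ be a finitely generated group, $B$ a finitely related group, $n\ge 0$ an integer, and $\phi:A\to B$ a homomorphism inducing a monomorphism on $H_1(-;\mathbb{Q})$ and an epimorphism $H_2(A;\mathbb{Q})\to H_2(B;\mathbb{Q})/\langle\Phi^{(n)}_H(B)\rangle$. Then for every $0\le m\le n+1$, $\phi$ induces a monomorphism $A/A^{(m)}_H\hookrightarrow B/B^{(m)}_H$; in particular $A/A^{(n+1)}_H\hookrightarrow B/B^{(n+1)}_H$. If moreover $\phi$ induces an isomorphism on $H_1(-;\mathbb{Q})$, then $\phi$ induces a monomorphism $A^{(n)}_H/A^{(n+1)}_H\to B^{(n)}_H/B^{(n+1)}_H$, and these modules have the same rank over $\mathbb{Z}[A/A^{(n)}_H]$ and $\mathbb{Z}[B/B^{(n)}_H]$ respectively. -/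

import Mathlib

open CategoryTheory
open scoped RightActions commutatorElement

universe u

/-! ### Finitely related groups -/

/-- A group is finitely related if it has a presentation with finitely many relators
(and arbitrarily many generators). -/
def FinitelyRelated (G : Type u) [Group G] : Prop :=
  ∃ (X : Type u) (rels : Set (FreeGroup X)),
    rels.Finite ∧ Nonempty (G ≃* PresentedGroup rels)

/-! ### Homology with constant coefficients -/

noncomputable section Homology

/-- The trivial `G`-module `R`. The `ULift` only places the coefficient ring in the
universe of `G`, as Mathlib's group homology requires. -/
abbrev trivialCoeff (R : Type) [CommRing R] (G : Type u) [Group G] :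
    Rep.{u} (ULift.{u} R) G :=
  Rep.trivial (ULift.{u} R) G (ULift.{u} R)

/-- `H_n(G; R)` with trivial action of `G` on `R`. -/
abbrev Hlgy (R : Type) [CommRing R] (G : Type u) [Group G] (n : ℕ) :
    ModuleCat (ULift.{u} R) :=
  groupHomology (trivialCoeff R G) n

/-- The map `H_n(G; R) → H_n(H; R)` induced by a group homomorphism. -/
def Hlgy.map (R : Type) [CommRing R] {G H : Type u} [Group G] [Group H] (φ : G →* H) (n : ℕ) :
    Hlgy R G n →ₗ[ULift.{u} R] Hlgy R H n :=
  (groupHomology.map (A := trivialCoeff R G) (B := trivialCoeff R H) φ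
    (𝟙 (trivialCoeff R G)) n).hom

/-- The inclusion of coefficients `ℤ → ℚ`. -/
def coeffCast : ULift.{u} ℤ →+ ULift.{u} ℚ where
  toFun z := ⟨(z.down : ℚ)⟩
  map_zero' := by ext; simp
  map_add' x y := by ext; simp

/-- The map on chains induced by the inclusion of coefficients `ℤ → ℚ`. -/
def chainsCast (X : Type u) : (X →₀ ULift.{u} ℤ) →+ (X →₀ ULift.{u} ℚ) :=
  Finsupp.mapRange.addMonoidHom coeffCast

theorem chainsCast_single (X : Type u) (x : X) (a : ULift.{u} ℤ) :
    chainsCast X (Finsupp.single x a) = Finsupp.single x (coeffCast a) := by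
  simp [chainsCast]

theorem d21_chainsCast (G : Type u) [Group G] (c : G × G →₀ ULift.{u} ℤ) :
    groupHomology.d₂₁ (trivialCoeff ℚ G) (chainsCast (G × G) c) =
      chainsCast G (groupHomology.d₂₁ (trivialCoeff ℤ G) c) := by
  induction c using Finsupp.induction_linear with
  | zero => simp
  | add f g hf hg => simp only [map_add, hf, hg]
  | single g a =>
    rw [chainsCast_single, groupHomology.d₂₁_single, groupHomology.d₂₁_single]
    simp only [map_add, map_sub, chainsCast_single]
    rfl

theorem d32_chainsCast (G : Type u) [Group G] (c : G × G × G →₀ ULift.{u} ℤ) :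
    groupHomology.d₃₂ (trivialCoeff ℚ G) (chainsCast (G × G × G) c) =
      chainsCast (G × G) (groupHomology.d₃₂ (trivialCoeff ℤ G) c) := by
  induction c using Finsupp.induction_linear with
  | zero => simp
  | add f g hf hg => simp only [map_add, hf, hg]
  | single g a =>
    rw [chainsCast_single, groupHomology.d₃₂_single, groupHomology.d₃₂_single]
    simp only [map_add, map_sub, chainsCast_single]
    rfl

/-- The map on 2-cycles induced by `ℤ → ℚ`. -/
def cyclesCast (G : Type u) [Group G] :
    groupHomology.cycles₂ (trivialCoeff ℤ G) →+ groupHomology.cycles₂ (trivialCoeff ℚ G) where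
  toFun c := ⟨chainsCast (G × G) c.1, by
    have h : groupHomology.d₂₁ (trivialCoeff ℤ G) c.1 = 0 := c.2
    have := d21_chainsCast G c.1
    rw [h, map_zero] at this
    exact this⟩
  map_zero' := by ext1; simp
  map_add' x y := by ext1; exact map_add (chainsCast (G × G)) x.1 y.1

/-- The 2-cycle to homology class map as a surjection onto `H_2(G; ℤ)`. -/
theorem H2pi_surjective (G : Type u) [Group G] :
    Function.Surjective
      (groupHomology.H2π (trivialCoeff ℤ G)).hom.toAddMonoidHom :=
  (ModuleCat.epi_iff_surjective _).1 inferInstance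

theorem H2pi_ker_le (G : Type u) [Group G] :
    (groupHomology.H2π (trivialCoeff ℤ G)).hom.toAddMonoidHom.ker ≤
      ((groupHomology.H2π (trivialCoeff ℚ G)).hom.toAddMonoidHom.comp (cyclesCast G)).ker := by
  intro c hc
  have hc' : groupHomology.H2π (trivialCoeff ℤ G) c = 0 := hc
  rw [groupHomology.H2π_eq_zero_iff] at hc'
  obtain ⟨e, he⟩ := hc'
  change groupHomology.H2π (trivialCoeff ℚ G) (cyclesCast G c) = 0
  rw [groupHomology.H2π_eq_zero_iff]
  refine ⟨chainsCast (G × G × G) e, ?_⟩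
  have := d32_chainsCast G e
  refine this.trans ?_
  exact congrArg (chainsCast (G × G)) he

/-- The natural map `H_2(G; ℤ) → H_2(G; ℚ)`, sending the class of an integral cycle to the class
of the same cycle with rational coefficients. -/
def H2IntToRat (G : Type u) [Group G] : Hlgy ℤ G 2 →+ Hlgy ℚ G 2 :=
  (AddMonoidHom.liftOfSurjective _ (H2pi_surjective G)) ⟨_, H2pi_ker_le G⟩

theorem H2IntToRat_H2pi (G : Type u) [Group G] (c : groupHomology.cycles₂ (trivialCoeff ℤ G)) :
    H2IntToRat G (groupHomology.H2π (trivialCoeff ℤ G) c) =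
      groupHomology.H2π (trivialCoeff ℚ G) (cyclesCast G c) :=
  AddMonoidHom.liftOfRightInverse_comp_apply _ _ _ _ c

/-- `Φ^N(G)`: the image of `H_2(N; ℤ) → H_2(G; ℤ)` induced by inclusion
(the classes represented by `N`-surfaces of `G`). -/
def PhiSub {G : Type u} [Group G] (N : Subgroup G) : Set (Hlgy ℤ G 2) :=
  Set.range (Hlgy.map ℤ N.subtype 2)

/-- `⟨Φ^N(G)⟩`: the rational subspace of `H_2(G; ℚ)` spanned by `Φ^N(G)`. -/
def PhiSpan {G : Type u} [Group G] (N : Subgroup G) :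
    Submodule (ULift.{u} ℚ) (Hlgy ℚ G 2) :=
  Submodule.span (ULift.{u} ℚ) (H2IntToRat G '' PhiSub N)

end Homology

/-! ### The right `ℤ[G/N]`-modules `N/K` -/

noncomputable section ConjugationModule

variable {G : Type u} [Group G]

/-- The quotient `N/K`, written additively, where `N`, `K` are normal in `G` and
`[N, N] ≤ K`. -/
def ConjQuot (N K : Subgroup G) [N.Normal] [K.Normal] (_h : ⁅N, N⁆ ≤ K) : Type u :=
  Additive (N ⧸ K.subgroupOf N)

variable (N K : Subgroup G) [N.Normal] [K.Normal] (h : ⁅N, N⁆ ≤ K)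

instance ConjQuot.instAddCommGroup : AddCommGroup (ConjQuot N K h) :=
  { (inferInstance : AddGroup (Additive (N ⧸ K.subgroupOf N))) with
    add_comm := by
      intro a b
      change (N ⧸ K.subgroupOf N) at a
      change (N ⧸ K.subgroupOf N) at b
      change a * b = b * a
      induction a using QuotientGroup.induction_on with
      | H x =>
        induction b using QuotientGroup.induction_on with
        | H y =>
          rw [← QuotientGroup.mk_mul, ← QuotientGroup.mk_mul, QuotientGroup.eq]
          rw [Subgroup.mem_subgroupOf]
          have : ((x * y)⁻¹ * (y * x) : N) = ⁅y⁻¹, x⁻¹⁆ := by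
            simp [commutatorElement_def, mul_assoc]
          rw [this]
          exact h (Subgroup.commutator_mem_commutator (y⁻¹).2 (x⁻¹).2) }

/-- The class `[x]` of `x ∈ N` in `N/K`. -/
def ConjQuot.mk (x : N) : ConjQuot N K h :=
  Additive.ofMul (x : N ⧸ K.subgroupOf N)

theorem ConjQuot.mk_surjective : Function.Surjective (ConjQuot.mk N K h) :=
  fun q => QuotientGroup.mk_surjective (s := K.subgroupOf N) q

theorem ConjQuot.mk_eq_zero_iff (x : N) : ConjQuot.mk N K h x = 0 ↔ (x : G) ∈ K :=
  (QuotientGroup.eq_one_iff x).trans Subgroup.mem_subgroupOf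

/-- The endomorphism `[x] ↦ [g⁻¹ x g]` of `N/K`. -/
def ConjQuot.conj (g : G) : AddMonoid.End (ConjQuot N K h) :=
  MonoidHom.toAdditive (QuotientGroup.map (K.subgroupOf N) (K.subgroupOf N)
    (MulAut.conjNormal g⁻¹ : N ≃* N).toMonoidHom (by
      intro x hx
      rw [Subgroup.mem_subgroupOf] at hx
      simpa [Subgroup.mem_subgroupOf] using
        Subgroup.Normal.conj_mem (inferInstance : K.Normal) _ hx g⁻¹))

theorem ConjQuot.conj_mk (g : G) (x : N) :
    ConjQuot.conj N K h g (ConjQuot.mk N K h x) =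
      ConjQuot.mk N K h (MulAut.conjNormal g⁻¹ x) := rfl

/-- Conjugation as a right action: an anti-homomorphism `G → End(N/K)`. -/
def ConjQuot.conjHom : G →* (AddMonoid.End (ConjQuot N K h))ᵐᵒᵖ where
  toFun g := MulOpposite.op (ConjQuot.conj N K h g)
  map_one' := by
    apply MulOpposite.unop_injective
    ext m
    obtain ⟨x, rfl⟩ := ConjQuot.mk_surjective N K h m
    simp [ConjQuot.conj_mk]
  map_mul' g g' := by
    apply MulOpposite.unop_injective
    ext m
    obtain ⟨x, rfl⟩ := ConjQuot.mk_surjective N K h m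
    simp [ConjQuot.conj_mk]

/-- The right action of `G/N` on `N/K`; it is well defined since `[N, N] ≤ K`. -/
def ConjQuot.quotHom : (G ⧸ N) →* (AddMonoid.End (ConjQuot N K h))ᵐᵒᵖ :=
  QuotientGroup.lift N (ConjQuot.conjHom N K h) (by
    intro g hg
    apply MulOpposite.unop_injective
    ext m
    obtain ⟨x, rfl⟩ := ConjQuot.mk_surjective N K h m
    change ConjQuot.mk N K h (MulAut.conjNormal g⁻¹ x) = ConjQuot.mk N K h x
    refine (QuotientGroup.eq (s := K.subgroupOf N)).2 ?_
    rw [Subgroup.mem_subgroupOf]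
    have : (((MulAut.conjNormal g⁻¹ x)⁻¹ * x : N) : G) = ⁅g⁻¹, (x : G)⁻¹⁆ := by
      simp [commutatorElement_def, mul_assoc]
    rw [this]
    exact h (Subgroup.commutator_mem_commutator (N.inv_mem hg) (N.inv_mem x.2)))

/-- The structure of a right `ℤ[G/N]`-module on `N/K` given by `[x]g = [g⁻¹ x g]`. -/
instance ConjQuot.instModule :
    Module (MonoidAlgebra ℤ (G ⧸ N))ᵐᵒᵖ (ConjQuot N K h) :=
  Module.compHom (ConjQuot N K h)
    ((RingEquiv.opOp (AddMonoid.End (ConjQuot N K h))).symm.toRingHom.comp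
      (RingHom.op (MonoidAlgebra.lift ℤ ((AddMonoid.End (ConjQuot N K h))ᵐᵒᵖ) (G ⧸ N)
        (ConjQuot.quotHom N K h)).toRingHom))

theorem ConjQuot.mk_smul_of (g : G) (x : N) :
    ConjQuot.mk N K h x <• (MonoidAlgebra.of ℤ (G ⧸ N) (g : G ⧸ N)) =
      ConjQuot.mk N K h (MulAut.conjNormal g⁻¹ x) := by
  change MulOpposite.unop (MonoidAlgebra.lift ℤ ((AddMonoid.End (ConjQuot N K h))ᵐᵒᵖ) (G ⧸ N)
        (ConjQuot.quotHom N K h) (MonoidAlgebra.of ℤ (G ⧸ N) (g : G ⧸ N))) _ = _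
  rw [MonoidAlgebra.lift_of]
  rfl

/-! ### The torsion-free derived series -/

/-- The elements `x ∈ N` whose class in the right `ℤ[G/N]`-module `N/[N, N]` is torsion, i.e.
`[x]γ = 0` for some non-zero `γ ∈ ℤ[G/N]`. -/
def torsionPreimage (N : Subgroup G) [N.Normal] : Set G :=
  {y | ∃ x : N, (x : G) = y ∧ ∃ γ : MonoidAlgebra ℤ (G ⧸ N), γ ≠ 0 ∧
    ConjQuot.mk N ⁅N, N⁆ le_rfl x <• γ = 0}

/-- The inverse image in `N` of the torsion of `N/[N, N]`, as a subgroup of `G`. For the groups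
`N` in the torsion-free derived series the ring `ℤ[G/N]` is an Ore domain, so that
`torsionPreimage N` is itself a subgroup and taking the closure adds nothing. -/
def torsionStep (N : Subgroup G) [N.Normal] : Subgroup G :=
  Subgroup.closure (torsionPreimage N)

theorem torsionPreimage_conj (N : Subgroup G) [N.Normal] {y : G} (hy : y ∈ torsionPreimage N)
    (g : G) : g * y * g⁻¹ ∈ torsionPreimage N := by
  obtain ⟨x, rfl, γ, hγ, hx⟩ := hy
  refine ⟨MulAut.conjNormal g x, by simp,
    MonoidAlgebra.of ℤ (G ⧸ N) (g : G ⧸ N) * γ, ?_, ?_⟩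
  · intro h0
    apply hγ
    have := congrArg (fun z => MonoidAlgebra.of ℤ (G ⧸ N) ((g : G ⧸ N)⁻¹) * z) h0
    simpa only [mul_zero, ← mul_assoc, ← map_mul, inv_mul_cancel, map_one, one_mul] using this
  · rw [MulOpposite.op_mul, mul_smul, ConjQuot.mk_smul_of]
    simpa using hx

instance torsionStep_normal (N : Subgroup G) [N.Normal] : (torsionStep N).Normal :=
  Subgroup.Normal.mk fun n hn g => by
    have hle : torsionStep N ≤ (torsionStep N).comap (MulAut.conj g).toMonoidHom :=
      (Subgroup.closure_le _).2 fun y hy =>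
        Subgroup.subset_closure (torsionPreimage_conj N hy g)
    exact hle hn

theorem commutator_le_torsionStep (N : Subgroup G) [N.Normal] : ⁅N, N⁆ ≤ torsionStep N := by
  intro y hy
  have hyN : y ∈ N := Subgroup.commutator_le_right N N hy
  refine Subgroup.subset_closure ⟨⟨y, hyN⟩, rfl, 1, one_ne_zero, ?_⟩
  rw [MulOpposite.op_one, one_smul]
  exact (ConjQuot.mk_eq_zero_iff N ⁅N, N⁆ le_rfl ⟨y, hyN⟩).2 hy

/-- The torsion-free derived series together with the normality of its terms. -/
def tfDerivedAux (G : Type u) [Group G] : ℕ → {N : Subgroup G // N.Normal}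
  | 0 => ⟨⊤, inferInstance⟩
  | n + 1 =>
    haveI := (tfDerivedAux G n).2
    ⟨torsionStep (tfDerivedAux G n).1, inferInstance⟩

/-- The `n`-th term `G^{(n)}_H` of the torsion-free derived series of `G`: it starts with `G`, and
each further term is the inverse image in `G^{(n)}_H` of the `ℤ[G/G^{(n)}_H]`-torsion of
`G^{(n)}_H/[G^{(n)}_H, G^{(n)}_H]`. -/
def tfDerived (G : Type u) [Group G] (n : ℕ) : Subgroup G := (tfDerivedAux G n).1

instance tfDerived_normal (G : Type u) [Group G] (n : ℕ) : (tfDerived G n).Normal :=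
  (tfDerivedAux G n).2

theorem tfDerived_zero (G : Type u) [Group G] : tfDerived G 0 = ⊤ := rfl

theorem tfDerived_succ (G : Type u) [Group G] (n : ℕ) :
    tfDerived G (n + 1) = torsionStep (tfDerived G n) := rfl

theorem commutator_tfDerived_le (G : Type u) [Group G] (n : ℕ) :
    ⁅tfDerived G n, tfDerived G n⁆ ≤ tfDerived G (n + 1) :=
  commutator_le_torsionStep (tfDerived G n)

/-- The right `ℤ[G/G^{(n)}_H]`-module `G^{(n)}_H/G^{(n+1)}_H`. -/
abbrev tfDerivedQuot (G : Type u) [Group G] (n : ℕ) : Type u :=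
  ConjQuot (tfDerived G n) (tfDerived G (n + 1)) (commutator_tfDerived_le G n)

/-- The class of an element of `G^{(n)}_H` in `G^{(n)}_H/G^{(n+1)}_H`. -/
abbrev tfDerivedQuot.mk (G : Type u) [Group G] (n : ℕ) (x : tfDerived G n) : tfDerivedQuot G n :=
  ConjQuot.mk (tfDerived G n) (tfDerived G (n + 1)) (commutator_tfDerived_le G n) x

/-- The rank of `G^{(n)}_H/G^{(n+1)}_H` as a right module over `ℤ[G/G^{(n)}_H]`: the supremum of
the cardinalities of linearly independent subsets. Over the Ore domain `ℤ[G/G^{(n)}_H]` it is the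
largest `m` for which the module has a free submodule of rank `m`, and the dimension after tensoring
with the skew field of quotients. -/
def tfDerivedRank (G : Type u) [Group G] (n : ℕ) : Cardinal.{u} :=
  Module.rank (MonoidAlgebra ℤ (G ⧸ tfDerived G n))ᵐᵒᵖ (tfDerivedQuot G n)

end ConjugationModule

/-!
The two parts of the theorem are read off from crossed homomorphisms (derivations) `D : B → K`,
where `K` is a skew field that contains `ℤ[B/B^{(m)}_H]`.

*Crossed homomorphisms see the torsion-free derived series.* Let `N = G^{(m)}_H`. The group ring
`ℤ[G/N]` is a domain (`G/N` has unique products, being poly-(torsion-free abelian)) and satisfies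
the strong rank condition (`G/N` is solvable, and an injection `Rⁿ⁺¹ → Rⁿ` would contradict the
polynomial growth of abelian groups), hence it is an Ore domain with a skew field of fractions `K`,
and `K` is an injective module over it (`baer_of_leftOre`). A crossed homomorphism `G → K` restricts
to a linear map `N/[N, N] → K`; conversely every such linear map is a restriction, because
`N/[N, N]` embeds into the module that carries the universal crossed homomorphism
(`exists_isCrossedHom_of_semilinear`, the Magnus embedding). Therefore `G^{(m+1)}_H` consists of the
elements of `N` on which all crossed homomorphisms vanish, and the functionals on
`G^{(m)}_H/G^{(m+1)}_H` are the crossed homomorphisms modulo the inner ones.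

*Crossed homomorphisms extend from `A` to `B`* (`IsCrossedHom.exists_extension`). In terms of
presentations, with `A` finitely generated and `B` finitely related, the statement is that the
kernel of a matrix of Fox derivatives over `ℤ[Γ]`, with `Γ = B/B^{(m)}_H` and finitely many rows, is
generated up to torsion by the elements that come from relations of `A`. Vectors over `ℤ[Γ]` with linearly independent augmentations are themselves
independent (`augmentationDetects_tfDerived`), so that ranks do not decrease when passing from `ℚ`
to `ℤ[Γ]`, and a count of ranks reduces the statement to one over `ℚ`
(`exists_smul_mem_span_of_ker`). The latter concerns homomorphisms to `ℚ` on the relations of `B`,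
that is, classes in `H²(B; ℚ)`: such a class vanishes if it vanishes on `A` and on `B^{(n)}_H`, by
the hypothesis on `H_2`, and the ambiguity in its trivialization is removed by the hypothesis on
`H_1` (`exists_additive_extension`). The classes that
occur do vanish on `B^{(n)}_H`, since for `m ≤ n` this subgroup acts trivially on `ℤ[Γ]`.

By induction on `m ≤ n + 1` it follows that `φ a ∈ B^{(m)}_H` if and only if `a ∈ A^{(m)}_H`. If `φ`
is an isomorphism on `H_1(-; ℚ)`, the same comparison of ranks shows that a crossed homomorphism on
`B` is determined by its restriction to `A` (`IsCrossedHom.eq_zero_of_comp_eq_zero`). Hence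
restriction is a bijection between the `K`-valued functionals on the modules
`B^{(n)}_H/B^{(n+1)}_H` and `A^{(n)}_H/A^{(n+1)}_H`, and the ranks agree
(`rank_eq_of_restriction_bijective`).
-/

/-! ### Unique products and group extensions -/

/-- An extension of groups with unique products has unique products: a product that is unique in the
quotient is chosen first, and then one that is unique in the fibres above its factors. -/
theorem UniqueProds.of_ker {G Q : Type*} [Group G] [Group Q] (π : G →* Q) [UniqueProds Q]
    [UniqueProds π.ker] : UniqueProds G where
  uniqueMul_of_nonempty {A B} hA hB := by
    classical
    obtain ⟨aH, haH, bH, hbH, hu⟩ :=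
      UniqueProds.uniqueMul_of_nonempty (hA.image π) (hB.image π)
    obtain ⟨a₁, ha₁, rfl⟩ := Finset.mem_image.1 haH
    obtain ⟨b₁, hb₁, rfl⟩ := Finset.mem_image.1 hbH
    have hl : Function.Injective fun n : π.ker => a₁ * (n : G) := fun x y h =>
      Subtype.ext (mul_left_cancel h)
    have hr : Function.Injective fun n : π.ker => (n : G) * b₁ := fun x y h =>
      Subtype.ext (mul_right_cancel h)
    have h1 : (A.preimage _ hl.injOn).Nonempty := ⟨1, by simpa using ha₁⟩
    have h2 : (B.preimage _ hr.injOn).Nonempty := ⟨1, by simpa using hb₁⟩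
    obtain ⟨n, hn, m, hm, hnm⟩ := UniqueProds.uniqueMul_of_nonempty h1 h2
    rw [Finset.mem_preimage] at hn hm
    refine ⟨_, hn, _, hm, UniqueMul.of_image_filter (f := (π : G →ₙ* Q))
      (aH := π a₁) (bH := π b₁) (by simp [(MonoidHom.mem_ker).1 n.2])
      (by simp [(MonoidHom.mem_ker).1 m.2]) hu ?_⟩
    intro a b ha hb hab
    obtain ⟨haA, ha⟩ := Finset.mem_filter.1 ha
    obtain ⟨hbB, hb⟩ := Finset.mem_filter.1 hb
    have ha' : a₁⁻¹ * a ∈ π.ker := by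
      rw [MonoidHom.mem_ker, map_mul, map_inv, inv_mul_eq_one]; exact ha.symm
    have hb' : b * b₁⁻¹ ∈ π.ker := by
      rw [MonoidHom.mem_ker, map_mul, map_inv, mul_inv_eq_one]; exact hb
    have := @hnm ⟨_, ha'⟩ ⟨_, hb'⟩ (by simpa using haA) (by simpa using hbB) (by
      ext
      simp only [Subgroup.coe_mul]
      have : a * b = a₁ * (n : G) * ((m : G) * b₁) := hab
      calc a₁⁻¹ * a * (b * b₁⁻¹) = a₁⁻¹ * (a * b) * b₁⁻¹ := by group
        _ = _ := by rw [this]; group)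
    obtain ⟨e1, e2⟩ := this
    refine ⟨?_, ?_⟩
    · rw [← e1]; simp
    · rw [← e2]; simp

/-- Torsion-free commutative groups have unique products: the subgroup generated by two finite sets
is free abelian of finite rank. -/
theorem uniqueProds_of_torsionFree {G : Type*} [Group G] (hc : ∀ a b : G, a * b = b * a)
    (ht : ∀ (a : G) (n : ℕ), n ≠ 0 → a ^ n = 1 → a = 1) : UniqueProds G where
  uniqueMul_of_nonempty {A B} hA hB := by
    classical
    let _ : CommGroup G := { (inferInstance : Group G) with mul_comm := hc }
    let H : Subgroup G := Subgroup.closure ((A ∪ B : Finset G) : Set G)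
    have hAH : ∀ a ∈ A, a ∈ H := fun a ha =>
      Subgroup.subset_closure (by simp [ha])
    have hBH : ∀ a ∈ B, a ∈ H := fun a ha =>
      Subgroup.subset_closure (by simp [ha])
    have : Group.FG H := Group.closure_finset_fg _
    have : Monoid.FG H := Group.fg_iff_monoid_fg.1 inferInstance
    have : IsMulTorsionFree H := ⟨fun n hn x y hxy => by
      have h1 : ((x : G) / y) ^ n = 1 := by
        rw [div_pow, div_eq_one]
        exact congrArg Subtype.val hxy
      exact Subtype.ext (div_eq_one.1 (ht _ n hn h1))⟩
    have hi : Function.Injective (H.subtype) := Subtype.val_injective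
    have h1 : (A.preimage _ hi.injOn).Nonempty := by
      obtain ⟨a, ha⟩ := hA
      exact ⟨⟨a, hAH a ha⟩, by simpa using ha⟩
    have h2 : (B.preimage _ hi.injOn).Nonempty := by
      obtain ⟨a, ha⟩ := hB
      exact ⟨⟨a, hBH a ha⟩, by simpa using ha⟩
    obtain ⟨n, hn, m, hm, hnm⟩ := UniqueProds.uniqueMul_of_nonempty h1 h2
    rw [Finset.mem_preimage] at hn hm
    refine ⟨_, hn, _, hm, fun a b ha hb hab => ?_⟩
    have := @hnm ⟨a, hAH a ha⟩ ⟨b, hBH b hb⟩ (by simpa using ha) (by simpa using hb)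
      (Subtype.ext hab)
    exact ⟨congrArg Subtype.val this.1, congrArg Subtype.val this.2⟩

/-! ### The group ring of an extension as a free module over the group ring of the kernel -/

section Extension

variable {G Q : Type*} [Group G] [Group Q] (π : G →* Q) (s : Q → G) (hs : ∀ q, π (s q) = q)

/-- The group ring of `π.ker` inside the group ring of `G`. -/
noncomputable abbrev kerIncl : MonoidAlgebra ℤ π.ker →+* MonoidAlgebra ℤ G :=
  MonoidAlgebra.mapDomainRingHom ℤ π.ker.subtype

/-- The `π.ker`-part `g s(π g)⁻¹` of `g`, where `s` is a section of `π`. -/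
def kerPart (g : G) : π.ker :=
  ⟨g * (s (π g))⁻¹, by rw [MonoidHom.mem_ker, map_mul, map_inv, hs, mul_inv_cancel]⟩

/-- The coordinates of an element of `ℤ[G]` with respect to the basis of `ℤ[G]` over `ℤ[π.ker]`
(acting on the left) given by a section `s` of `π`. -/
noncomputable def kerCoord : MonoidAlgebra ℤ G →+ (Q →₀ MonoidAlgebra ℤ π.ker) :=
  (Finsupp.liftAddHom fun g : G => (Finsupp.singleAddHom (π g)).comp
    (MonoidAlgebra.singleAddHom (kerPart π s hs g))).comp
      (MonoidAlgebra.coeffAddEquiv (R := ℤ) (M := G)).toAddMonoidHom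

theorem kerCoord_single (g : G) (r : ℤ) :
    kerCoord π s hs (MonoidAlgebra.single g r) =
      Finsupp.single (π g) (MonoidAlgebra.single (kerPart π s hs g) r) := by
  simp [kerCoord]

theorem kerCoord_kerIncl_mul (a : MonoidAlgebra ℤ π.ker) (x : MonoidAlgebra ℤ G) :
    kerCoord π s hs (kerIncl π a * x) = a • kerCoord π s hs x := by
  induction a using MonoidAlgebra.induction_linear with
  | zero => simp
  | add a b ha hb => rw [map_add, add_mul, map_add, ha, hb, add_smul]
  | single n r =>
    induction x using MonoidAlgebra.induction_linear with
    | zero => simp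
    | add a b ha hb => rw [mul_add, map_add, ha, hb, map_add, smul_add]
    | single g t =>
      have hn : π (n : G) = 1 := n.2
      have e : kerPart π s hs ((n : G) * g) = n * kerPart π s hs g := by
        ext; simp [kerPart, hn, mul_assoc]
      simp [kerCoord_single, MonoidAlgebra.single_mul_single, hn, e]

theorem kerCoord_section (q : Q) :
    kerCoord π s hs (MonoidAlgebra.single (s q) 1) = Finsupp.single q 1 := by
  have e : kerPart π s hs (s q) = 1 := by ext; simp [kerPart, hs]
  rw [kerCoord_single, e, hs]; rfl

/-- Expansion of an element of `ℤ[G]` in the basis given by the section. -/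
theorem sum_kerCoord (x : MonoidAlgebra ℤ G) :
    (kerCoord π s hs x).sum (fun q a => kerIncl π a * MonoidAlgebra.single (s q) 1) = x := by
  induction x using MonoidAlgebra.induction_linear with
  | zero => simp
  | add a b ha hb =>
    rw [map_add, Finsupp.sum_add_index', ha, hb]
    · intro; simp
    · intro q a b; rw [map_add, add_mul]
  | single g r =>
    rw [kerCoord_single, Finsupp.sum_single_index (by simp)]
    simp [MonoidAlgebra.single_mul_single, kerPart]

theorem kerCoord_injective : Function.Injective (kerCoord π s hs) := fun x y h => by
  rw [← sum_kerCoord π s hs x, ← sum_kerCoord π s hs y, h]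

/-- The augmentation `ℤ[G] → ℤ`. -/
noncomputable def augm (G : Type*) [Group G] : MonoidAlgebra ℤ G →+* ℤ :=
  (MonoidAlgebra.lift ℤ ℤ G 1).toRingHom

theorem augm_single {G : Type*} [Group G] (g : G) (r : ℤ) :
    augm G (MonoidAlgebra.single g r) = r := by
  simp [augm]

theorem augm_mapDomain {G H : Type*} [Group G] [Group H] (f : G →* H) (x : MonoidAlgebra ℤ G) :
    augm H (MonoidAlgebra.mapDomainRingHom ℤ f x) = augm G x := by
  induction x using MonoidAlgebra.induction_linear with
  | zero => simp
  | add a b ha hb => rw [map_add, map_add, map_add, ha, hb]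
  | single g r => simp [augm_single]

theorem augm_kerCoord (x : MonoidAlgebra ℤ G) (q : Q) :
    augm π.ker (kerCoord π s hs x q) = (MonoidAlgebra.mapDomainRingHom ℤ π x).coeff q := by
  classical
  induction x using MonoidAlgebra.induction_linear with
  | zero => simp
  | add a b ha hb =>
    rw [map_add, map_add, Finsupp.add_apply, map_add, ha, hb, MonoidAlgebra.coeff_add,
      Finsupp.add_apply]
  | single g r =>
    rw [kerCoord_single]
    simp only [MonoidAlgebra.mapDomainRingHom_apply, MonoidAlgebra.mapDomain_single,
      MonoidAlgebra.coeff_single, Finsupp.single_apply]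
    split_ifs <;> simp [augm_single]

/-- The coordinates of `x` are indexed by the image of the support of `x`. -/
theorem exists_of_kerCoord_ne_zero (x : MonoidAlgebra ℤ G) (q : Q) (h : kerCoord π s hs x q ≠ 0) :
    ∃ g ∈ x.coeff.support, π g = q := by
  classical
  contrapose! h
  rw [← MonoidAlgebra.sum_coeff_single x, Finsupp.sum, map_sum, Finsupp.finsetSum_apply]
  refine Finset.sum_eq_zero fun g hg => ?_
  rw [kerCoord_single, Finsupp.single_apply, if_neg (h g hg)]

end Extension

/-! ### The strong rank condition for group rings of solvable groups -/

open scoped Pointwise in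
/-- Products of finitely many elements of a commutative group grow polynomially. -/
theorem card_pow_le_of_comm {Q : Type*} [Group Q] [DecidableEq Q]
    (hc : ∀ a b : Q, a * b = b * a) (S : Finset Q) (k : ℕ) :
    (S ^ k).card ≤ (k + 1) ^ S.card := by
  let _ : CommGroup Q := { (inferInstance : Group Q) with mul_comm := hc }
  let F : (S → Fin (k + 1)) → Q := fun e => ∏ t : S, (t : Q) ^ (e t : ℕ)
  have hsub : S ^ k ⊆ Finset.univ.image F := by
    intro a ha
    obtain ⟨f, rfl⟩ := Finset.mem_pow.1 ha
    refine Finset.mem_image.2 ⟨fun t =>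
      ⟨(Finset.univ.filter fun i => f i = t).card, Nat.lt_succ_of_le ?_⟩, Finset.mem_univ _, ?_⟩
    · simpa using Finset.card_filter_le (Finset.univ : Finset (Fin k)) fun i => f i = t
    · rw [List.prod_ofFn, ← Finset.prod_fiberwise (s := Finset.univ) (g := f)
        (f := fun i => (f i : Q))]
      refine Finset.prod_congr rfl fun t _ => ?_
      rw [Finset.prod_congr rfl fun i hi => by rw [(Finset.mem_filter.1 hi).2], Finset.prod_const]
  calc (S ^ k).card ≤ (Finset.univ.image F).card := Finset.card_le_card hsub
    _ ≤ _ := Finset.card_image_le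
    _ = _ := by simp

/-- A sequence of positive integers with `(n + 1) a_k ≤ n a_(k+1)` outgrows every polynomial. -/
theorem not_poly_growth (a : ℕ → ℕ) (n c : ℕ) (h0 : 0 < a 0)
    (hrec : ∀ k, (n + 1) * a k ≤ n * a (k + 1)) (hle : ∀ k, a k ≤ (k + 1) ^ c) : False := by
  have hn : 0 < n := by
    rcases Nat.eq_zero_or_pos n with rfl | h
    · have := hrec 0; omega
    · exact h
  have hnR : (0 : ℝ) < n := by exact_mod_cast hn
  set r : ℝ := (n + 1) / n with hr
  have hr1 : 1 < r := by rw [hr, lt_div_iff₀ hnR]; linarith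
  have hge : ∀ k, r ^ k ≤ a k := by
    intro k
    induction k with
    | zero => simpa using (by exact_mod_cast h0 : (1 : ℝ) ≤ a 0)
    | succ k ih =>
      have h1 : ((n : ℝ) + 1) * a k ≤ n * a (k + 1) := by exact_mod_cast hrec k
      have h2 : r * a k ≤ a (k + 1) := by
        rw [hr, div_mul_eq_mul_div, div_le_iff₀ hnR]; linarith
      calc r ^ (k + 1) = r * r ^ k := by ring
        _ ≤ r * a k := by gcongr
        _ ≤ _ := h2
  have hlim := tendsto_pow_const_div_const_pow_of_one_lt c hr1
  have hlim2 := (hlim.comp (Filter.tendsto_add_atTop_nat 1)).eventually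
    (gt_mem_nhds (show (0 : ℝ) < 1 / r by positivity))
  obtain ⟨k, hk⟩ := hlim2.exists
  simp only [Function.comp] at hk
  have h3 : (a k : ℝ) ≤ ((k + 1 : ℕ) : ℝ) ^ c := by exact_mod_cast hle k
  have h4 := hge k
  rw [div_lt_div_iff₀ (by positivity) (by positivity), pow_succ] at hk
  have hr0 : 0 < r := by linarith
  nlinarith

section Src

variable {G Q : Type*} [Group G] [Group Q] (π : G →* Q)

open scoped Pointwise in
/-- If an injection `ℤ[G]ⁿ⁺¹ → ℤ[G]ⁿ` existed, restricting it to the elements supported over the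
finite subset `T` of the quotient would give an injection of free modules over the group ring of the
kernel; here `S` contains the image of the support of its matrix. -/
theorem card_le_of_injective_groupRing [StrongRankCondition (MonoidAlgebra ℤ π.ker)]
    [DecidableEq Q] (hπ : Function.Surjective π) {n : ℕ}
    (f : (Fin (n + 1) → MonoidAlgebra ℤ G) →ₗ[MonoidAlgebra ℤ G] (Fin n → MonoidAlgebra ℤ G))
    (hf : Function.Injective f) (S : Finset Q)
    (hS : ∀ i j, ∀ g ∈ (f (Pi.single i 1) j).coeff.support, π g ∈ S) (T : Finset Q) :
    (n + 1) * T.card ≤ n * (T * S).card := by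
  classical
  let s := Function.surjInv hπ
  have hs : ∀ q, π (s q) = q := Function.surjInv_eq hπ
  let v : Fin (n + 1) × T → (Fin n × (T * S : Finset Q) → MonoidAlgebra ℤ π.ker) := fun p c =>
    kerCoord π s hs (MonoidAlgebra.single (s p.2) 1 * f (Pi.single p.1 1) c.1) c.2
  have key : Function.Injective (Fintype.linearCombination (MonoidAlgebra ℤ π.ker) v) := by
    rw [← LinearMap.ker_eq_bot, LinearMap.ker_eq_bot']
    intro a ha
    let lam : Fin (n + 1) → MonoidAlgebra ℤ G := fun i =>
      ∑ t : T, kerIncl π (a (i, t)) * MonoidAlgebra.single (s t) 1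
    have hcoord : ∀ i, kerCoord π s hs (lam i) = ∑ t : T, Finsupp.single (t : Q) (a (i, t)) := by
      intro i
      simp only [lam, map_sum, kerCoord_kerIncl_mul, kerCoord_section, Finsupp.smul_single,
        smul_eq_mul, mul_one]
    have hflam : f lam = 0 := by
      funext j
      have e1 : f lam j = ∑ i, ∑ t : T,
          kerIncl π (a (i, t)) * (MonoidAlgebra.single (s t) 1 * f (Pi.single i 1) j) := by
        have : lam = ∑ i, lam i • Pi.single i (1 : MonoidAlgebra ℤ G) := by
          funext i; simp [Finset.sum_apply, Pi.single_apply]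
        rw [this, map_sum, Finset.sum_apply]
        refine Finset.sum_congr rfl fun i _ => ?_
        rw [map_smul, Pi.smul_apply, smul_eq_mul]
        simp only [lam, Finset.sum_mul, mul_assoc]
      apply kerCoord_injective π s hs
      rw [Pi.zero_apply, map_zero, e1]
      ext1 q
      simp only [map_sum, kerCoord_kerIncl_mul, Finsupp.finsetSum_apply, Finsupp.smul_apply,
        Finsupp.zero_apply, smul_eq_mul]
      by_cases hq : q ∈ T * S
      · have := congrFun ha (j, ⟨q, hq⟩)
        rw [Fintype.linearCombination_apply, Finset.sum_apply, Fintype.sum_prod_type] at this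
        simpa [v] using this
      · refine Finset.sum_eq_zero fun i _ => Finset.sum_eq_zero fun t _ => ?_
        by_contra hne
        obtain ⟨g, hg, rfl⟩ := exists_of_kerCoord_ne_zero π s hs _ _ (right_ne_zero_of_mul hne)
        obtain ⟨g', hg', rfl⟩ : ∃ g' ∈ (f (Pi.single i 1) j).coeff.support, s t * g' = g := by
          refine ⟨(s t)⁻¹ * g, ?_, by simp⟩
          rw [Finsupp.mem_support_iff] at hg ⊢
          rw [MonoidAlgebra.coeff_single_mul_eq_mul_coeff ((s t)⁻¹ * g)
            (fun m _ => by rw [eq_inv_mul_iff_mul_eq])] at hg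
          simpa using hg
        apply hq
        rw [map_mul, hs]
        exact Finset.mul_mem_mul t.2 (hS i j g' hg')
    have hlam : lam = 0 := hf (by rw [hflam, map_zero])
    funext ⟨i, t⟩
    have := hcoord i
    rw [hlam, Pi.zero_apply, map_zero] at this
    have h2 := DFunLike.congr_fun this (t : Q)
    rw [Finsupp.finsetSum_apply, Finset.sum_eq_single t] at h2
    · simpa using h2.symm
    · intro b _ hb
      rw [Finsupp.single_apply, if_neg (fun h => hb (Subtype.ext h))]
    · simp
  have := card_le_of_injective _ _ key
  simpa using this

/-- The strong rank condition passes to extensions with commutative quotient: an injection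
`ℤ[G]ⁿ⁺¹ → ℤ[G]ⁿ` would make the powers of a finite subset of the quotient grow exponentially. -/
theorem strongRankCondition_of_extension [StrongRankCondition (MonoidAlgebra ℤ π.ker)]
    (hπ : Function.Surjective π) (hc : ∀ a b : Q, a * b = b * a) :
    StrongRankCondition (MonoidAlgebra ℤ G) := by
  classical
  open scoped Pointwise in
  refine (strongRankCondition_iff_succ _).2 fun n f hf => ?_
  let S : Finset Q := Finset.univ.biUnion fun i : Fin (n + 1) => Finset.univ.biUnion fun j =>
    (f (Pi.single i 1) j).coeff.support.image π
  have hS : ∀ i j, ∀ g ∈ (f (Pi.single i 1) j).coeff.support, π g ∈ S := fun i j g hg =>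
    Finset.mem_biUnion.2 ⟨i, Finset.mem_univ _, Finset.mem_biUnion.2 ⟨j, Finset.mem_univ _,
      Finset.mem_image_of_mem _ hg⟩⟩
  refine not_poly_growth (fun k => (S ^ k).card) n S.card (by simp) (fun k => ?_)
    (card_pow_le_of_comm hc S)
  have := card_le_of_injective_groupRing π hπ f hf S hS (S ^ k)
  rwa [← pow_succ] at this

end Src

theorem derivedSeries_commutator_eq_bot {G : Type*} [Group G] (n : ℕ)
    (h : derivedSeries G (n + 1) = ⊥) : derivedSeries (commutator G) n = ⊥ := by
  have key : ∀ k, (derivedSeries (commutator G) k).map (commutator G).subtype =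
      derivedSeries G (k + 1) := by
    intro k
    induction k with
    | zero =>
      rw [derivedSeries_one, derivedSeries_zero, ← MonoidHom.range_eq_map, Subgroup.range_subtype]
    | succ k ih =>
      rw [derivedSeries_succ, Subgroup.map_commutator, ih, derivedSeries_succ G (k + 1)]
  have := key n
  rwa [h, Subgroup.map_eq_bot_iff_of_injective _ Subtype.val_injective] at this

/-- The group ring of a solvable group satisfies the strong rank condition; if it is a domain, it is
therefore an Ore domain. -/
theorem strongRankCondition_of_derivedSeries_eq_bot (n : ℕ) :
    ∀ (G : Type u) [Group G], derivedSeries G n = ⊥ →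
      StrongRankCondition (MonoidAlgebra ℤ G) := by
  induction n with
  | zero =>
    intro G _ h
    have hs : Subsingleton G := by
      rw [derivedSeries_zero] at h
      exact (Subgroup.subsingleton_iff).1 (subsingleton_of_bot_eq_top h.symm)
    let _ : CommGroup G := { (inferInstance : Group G) with
      mul_comm := fun a b => Subsingleton.elim _ _ }
    infer_instance
  | succ n ih =>
    intro G _ h
    have := ih (commutator G) (derivedSeries_commutator_eq_bot n h)
    have hk : (Abelianization.of : G →* Abelianization G).ker = commutator G :=
      Abelianization.ker_of G
    have : StrongRankCondition
        (MonoidAlgebra ℤ (Abelianization.of : G →* Abelianization G).ker) := by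
      rw [hk]; exact this
    exact strongRankCondition_of_extension (Abelianization.of : G →* Abelianization G)
      (QuotientGroup.mk'_surjective _) mul_comm

/-! ### Linear independence detected by the augmentation -/

/-- Vectors over a commutative domain `R` whose images under a ring homomorphism `R → ℤ` are
linearly independent are linearly independent: some minor has non-zero image. -/
theorem linearIndependent_of_ringHom_int {R : Type*} [CommRing R] [IsDomain R] (ε : R →+* ℤ)
    {I J : Type*} (w : I → J →₀ R)
    (h : LinearIndependent ℤ fun i => (w i).mapRange ε (map_zero ε)) :
    LinearIndependent R w := by
  classical
  rw [linearIndependent_iff_finset_linearIndependent]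
  intro s
  set w' : s → J →₀ R := w ∘ Subtype.val with hw'
  have h1 : LinearIndependent ℤ fun i : s => (w' i).mapRange ε (map_zero ε) :=
    h.comp _ Subtype.val_injective
  have h2 : LinearIndependent ℚ fun i : s =>
      ((w' i).mapRange ε (map_zero ε)).mapRange (Int.castAddHom ℚ) (map_zero _) := by
    rw [← LinearIndependent.iff_fractionRing ℤ ℚ]
    have := h1.map' (Finsupp.mapRange.linearMap (Int.castAddHom ℚ).toIntLinearMap)
      (LinearMap.ker_eq_bot.2
        (Finsupp.mapRange_injective _ (map_zero _) Int.cast_injective))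
    exact this
  set u : s → J →₀ ℚ := fun i : s =>
      ((w' i).mapRange ε (map_zero ε)).mapRange (Int.castAddHom ℚ) (map_zero _) with hu
  -- `c` is a left inverse over `ℚ` of the matrix `u`. Clearing its denominators by `d` gives an
  -- integral matrix `C`, and the product `M` of `w'` and `C` satisfies `ε(M) = d • 1`.
  obtain ⟨c, hc⟩ := LinearMap.exists_leftInverse_of_injective _
    (LinearMap.ker_eq_bot.2 h2.fintypeLinearCombination_injective)
  have hcu : ∀ i k, c (u i) k = if i = k then 1 else 0 := by
    intro i k
    have := congrFun (LinearMap.congr_fun hc (Pi.single i 1)) k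
    rw [LinearMap.comp_apply, Fintype.linearCombination_apply_single, one_smul] at this
    rw [this]; simp [Pi.single_apply, eq_comm]
  let F : Finset J := Finset.univ.biUnion fun i : s => (w' i).support
  obtain ⟨d, hd⟩ := IsLocalization.exist_integer_multiples_of_finset (nonZeroDivisors ℤ)
    (Finset.univ.biUnion fun k : s => F.image fun j => c (Finsupp.single j 1) k)
  have hint : ∀ (j : F) (k : s), ∃ z : ℤ, (z : ℚ) = (d : ℤ) * c (Finsupp.single (j : J) 1) k := by
    intro j k
    obtain ⟨z, hz⟩ := hd (c (Finsupp.single (j : J) 1) k) (Finset.mem_biUnion.2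
      ⟨k, Finset.mem_univ _, Finset.mem_image_of_mem _ j.2⟩)
    refine ⟨z, ?_⟩
    simpa using hz
  choose C hC using hint
  let M : Matrix s s R := fun i k => ∑ j : F, w' i j * (C j k : R)
  have hwF : ∀ (i : s) (j : J), j ∉ F → w' i j = 0 := by
    intro i j hj
    by_contra hne
    exact hj (Finset.mem_biUnion.2 ⟨i, Finset.mem_univ _, Finsupp.mem_support_iff.2 hne⟩)
  have hεM : ε.mapMatrix M = (d : ℤ) • (1 : Matrix s s ℤ) := by
    ext i k
    have e1 : c (u i) k = ∑ j : F, (ε (w' i j) : ℚ) * c (Finsupp.single (j : J) 1) k := by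
      have : u i = ∑ j : F, (ε (w' i j) : ℚ) • Finsupp.single (j : J) (1 : ℚ) := by
        ext j
        simp only [hu, Finsupp.mapRange_apply, Finsupp.finsetSum_apply, Finsupp.smul_apply,
          Finsupp.single_apply, smul_eq_mul, mul_ite, mul_one, mul_zero]
        by_cases hj : j ∈ F
        · rw [Finset.sum_eq_single ⟨j, hj⟩]
          · simp
          · intro b _ hb
            rw [if_neg fun h => hb (Subtype.ext h)]
          · simp
        · rw [hwF i j hj, Finset.sum_eq_zero]
          · simp
          · intro b _
            rw [if_neg]
            rintro rfl
            exact hj b.2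
      rw [this, map_sum, Finset.sum_apply]
      exact Finset.sum_congr rfl fun j _ => by rw [map_smul, Pi.smul_apply, smul_eq_mul]
    have e2 : ((ε (M i k) : ℤ) : ℚ) = (d : ℤ) * c (u i) k := by
      simp only [M, map_sum, map_mul, map_intCast, Int.cast_sum, Int.cast_mul, Int.cast_id, hC]
      rw [e1, Finset.mul_sum]
      refine Finset.sum_congr rfl fun j _ => by ring
    rw [hcu] at e2
    rw [RingHom.mapMatrix_apply, Matrix.map_apply, Matrix.smul_apply, Matrix.one_apply]
    by_cases hik : i = k
    · rw [if_pos hik] at e2 ⊢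
      rw [smul_eq_mul]; exact_mod_cast e2
    · rw [if_neg hik] at e2 ⊢
      rw [smul_zero]; rw [mul_zero] at e2; exact_mod_cast e2
  have hdet : M.det ≠ 0 := by
    intro h0
    have := congrArg ε h0
    rw [RingHom.map_det, hεM, map_zero, Matrix.det_smul, Matrix.det_one, mul_one] at this
    exact nonZeroDivisors.coe_ne_zero d (by by_contra hne; exact pow_ne_zero _ hne this)
  rw [Fintype.linearIndependent_iff]
  intro a ha
  have hv : Matrix.vecMul a M = 0 := by
    funext k
    simp only [Matrix.vecMul, dotProduct, M, Pi.zero_apply]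
    simp_rw [Finset.mul_sum, ← mul_assoc]
    rw [Finset.sum_comm]
    refine Finset.sum_eq_zero fun j _ => ?_
    rw [← Finset.sum_mul]
    have := DFunLike.congr_fun ha (j : J)
    simp only [Finsupp.finsetSum_apply, Finsupp.smul_apply, smul_eq_mul, Finsupp.zero_apply] at this
    rw [this, zero_mul]
  exact fun i => congrFun (Matrix.eq_zero_of_vecMul_eq_zero hdet hv) i

/-- Finite families in free modules over `ℤ[G]` are linearly independent as soon as their images
under the augmentation are linearly independent over `ℤ`. -/
def AugmentationDetects (G : Type u) [Group G] : Prop :=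
  ∀ (I J : Type u) [Fintype I] (v : I → J →₀ MonoidAlgebra ℤ G),
    (LinearIndependent ℤ fun i => (v i).mapRange (augm G) (map_zero _)) →
      LinearIndependent (MonoidAlgebra ℤ G) v

theorem linearIndependent_single_one (Q : Type*) [Group Q] :
    LinearIndependent ℤ fun q : Q => (MonoidAlgebra.single q 1 : MonoidAlgebra ℤ Q) := by
  rw [linearIndependent_iff']
  intro s g hg q hq
  classical
  have := congrArg (fun x => MonoidAlgebra.coeff x q) hg
  simpa [MonoidAlgebra.coeff_sum, Finsupp.single_apply, hq] using this

theorem AugmentationDetects.of_subsingleton (G : Type u) [Group G] [Subsingleton G] :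
    AugmentationDetects G := by
  intro I J _ v h
  have hinj : Function.Injective (augm G) := by
    intro x y hxy
    have key : ∀ z : MonoidAlgebra ℤ G, z = MonoidAlgebra.single 1 (augm G z) := by
      intro z
      induction z using MonoidAlgebra.induction_linear with
      | zero => simp
      | add a b ha hb => rw [map_add, MonoidAlgebra.single_add, ← ha, ← hb]
      | single g r => rw [augm_single, Subsingleton.elim g 1]
    rw [key x, key y, hxy]
  rw [Fintype.linearIndependent_iff] at h ⊢
  intro g hg i
  apply hinj
  rw [map_zero]
  refine h (fun i => augm G (g i)) ?_ i
  ext j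
  have := congrArg (augm G) (DFunLike.congr_fun hg j)
  simpa [Finsupp.finsetSum_apply] using this

/-- Independence over `ℤ[Q]` of the images of `v i` in the quotient means independence over `ℤ` of
the augmentations of the translates `s q • v i`, expressed in coordinates over the commutative
domain `ℤ[π.ker]`. Therefore these translates are independent over `ℤ[π.ker]`, which is the
independence of the `v i` over `ℤ[G]`. -/
theorem AugmentationDetects.of_extension {G Q : Type u} [Group G] [Group Q] (π : G →* Q)
    (hπ : Function.Surjective π) (hc : ∀ a b : π.ker, a * b = b * a)
    [IsDomain (MonoidAlgebra ℤ π.ker)] (hQ : AugmentationDetects Q) : AugmentationDetects G := by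
  intro I J _ v h
  classical
  let _ : CommGroup π.ker := { (inferInstance : Group π.ker) with mul_comm := hc }
  let s := Function.surjInv hπ
  have hs : ∀ q, π (s q) = q := Function.surjInv_eq hπ
  let vQ : I → J →₀ MonoidAlgebra ℤ Q := fun i =>
    (v i).mapRange (MonoidAlgebra.mapDomainRingHom ℤ π) (map_zero _)
  have hvQ : LinearIndependent (MonoidAlgebra ℤ Q) vQ := by
    apply hQ
    convert h using 2 with i
    ext j
    simp only [vQ, Finsupp.mapRange_apply, augm_mapDomain]
  have hvQ' := linearIndependent_smul (linearIndependent_single_one Q) hvQ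
  let w : Q × I → (J × Q →₀ MonoidAlgebra ℤ π.ker) := fun p =>
    Finsupp.uncurry (((MonoidAlgebra.single (s p.1) 1 : MonoidAlgebra ℤ G) • v p.2).mapRange
      (kerCoord π s hs) (map_zero _))
  have hwapp : ∀ p j q, w p (j, q) =
      kerCoord π s hs (MonoidAlgebra.single (s p.1) 1 * v p.2 j) q := fun p j q => rfl
  have hw : LinearIndependent (MonoidAlgebra ℤ π.ker) w := by
    apply linearIndependent_of_ringHom_int (augm π.ker)
    rw [linearIndependent_iff'] at hvQ' ⊢
    intro T g hg
    refine hvQ' T g ?_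
    ext j q
    have := DFunLike.congr_fun hg (j, q)
    simp only [Finsupp.finsetSum_apply, Finsupp.smul_apply, Finsupp.mapRange_apply, hwapp,
      augm_kerCoord, map_mul, Finsupp.zero_apply] at this
    simp only [Finsupp.finsetSum_apply, Finsupp.smul_apply, Finsupp.zero_apply,
      MonoidAlgebra.coeff_sum, MonoidAlgebra.coeff_smul, MonoidAlgebra.coeff_zero, vQ,
      Finsupp.mapRange_apply]
    rw [← this]
    refine Finset.sum_congr rfl fun p _ => ?_
    simp [hs]
  rw [Fintype.linearIndependent_iff]
  intro lam hlam i
  let T : Finset Q := Finset.univ.biUnion fun i => (kerCoord π s hs (lam i)).support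
  have hT : ∀ i, (∑ q ∈ T, kerIncl π (kerCoord π s hs (lam i) q) *
      MonoidAlgebra.single (s q) 1) = lam i := by
    intro i
    conv_rhs => rw [← sum_kerCoord π s hs (lam i)]
    rw [Finsupp.sum_of_support_subset (s := T)]
    · intro q hq
      exact Finset.mem_biUnion.2 ⟨i, Finset.mem_univ _, hq⟩
    · intros; simp
  rw [linearIndependent_iff'] at hw
  have h0 := hw (T ×ˢ Finset.univ) (fun p => kerCoord π s hs (lam p.2) p.1) (by
    ext1 ⟨j, q⟩
    have e : ∑ p ∈ T ×ˢ (Finset.univ : Finset I), kerIncl π (kerCoord π s hs (lam p.2) p.1) *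
        (MonoidAlgebra.single (s p.1) 1 * v p.2 j) = 0 := by
      rw [Finset.sum_product_right]
      have := DFunLike.congr_fun hlam j
      simp only [Finsupp.finsetSum_apply, Finsupp.smul_apply, smul_eq_mul,
        Finsupp.zero_apply] at this
      rw [← this]
      refine Finset.sum_congr rfl fun i _ => ?_
      conv_rhs => rw [← hT i, Finset.sum_mul]
      simp only [mul_assoc]
    have e2 := DFunLike.congr_fun (congrArg (kerCoord π s hs) e) q
    simpa only [map_sum, kerCoord_kerIncl_mul, Finsupp.finsetSum_apply, Finsupp.smul_apply,
      map_zero, Finsupp.zero_apply, hwapp] using e2)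
  apply kerCoord_injective π s hs
  rw [map_zero]
  ext1 q
  by_cases hq : q ∈ T
  · exact h0 (q, i) (Finset.mem_product.2 ⟨hq, Finset.mem_univ _⟩)
  · by_contra hne
    exact hq (Finset.mem_biUnion.2 ⟨i, Finset.mem_univ _, Finsupp.mem_support_iff.2 hne⟩)

/-! ### Ore domains and injectivity of their skew fields of fractions -/

/-- The left Ore condition: a left fraction `s⁻¹ t` is equal to `b a⁻¹`, without denominators. -/
def LeftOre (R : Type*) [Ring R] : Prop :=
  ∀ a b : R, a ≠ 0 → ∃ s t : R, s ≠ 0 ∧ s * b = t * a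

theorem leftOre_of_strongRankCondition (R : Type*) [Ring R] [IsDomain R]
    [StrongRankCondition R] : LeftOre R := by
  intro a b ha
  obtain ⟨t, s, h⟩ := OreLocalization.nonempty_oreSet_iff_of_noZeroDivisors.1
    (nonempty_oreSet_of_strongRankCondition (R := R)) b
    ⟨a, mem_nonZeroDivisors_of_ne_zero ha⟩
  exact ⟨s, t, nonZeroDivisors.coe_ne_zero s, h⟩

/-- A domain with the strong rank condition embeds into a skew field. -/
theorem exists_divisionRing_embedding (R : Type u) [Ring R] [IsDomain R] [StrongRankCondition R] :
    ∃ (K : Type u) (_ : DivisionRing K) (j : R →+* K), Function.Injective j := by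
  obtain ⟨h⟩ := nonempty_oreSet_of_strongRankCondition (R := R)
  exact ⟨OreLocalization (nonZeroDivisors R) R, inferInstance,
    OreLocalization.numeratorRingHom,
    OreLocalization.numeratorHom_inj fun a ha => ha.1⟩

section Injective

variable {R K : Type*} [Ring R] [DivisionRing K] (j : R →+* K) (hj : Function.Injective j)
  (hR : LeftOre R)

include hj hR in
/-- A skew field containing a left Ore domain `R` is an injective left `R`-module: every linear map
from a left ideal is a right multiplication. -/
theorem baer_of_leftOre :
    letI := Module.compHom K j
    Module.Baer R K := by
  let _ := Module.compHom K j
  intro I g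
  by_cases hI : ∃ a ∈ I, a ≠ 0
  · obtain ⟨a, haI, ha⟩ := hI
    have hja : j a ≠ 0 := fun h => ha (hj (by rw [h, map_zero]))
    let c : K := (j a)⁻¹ * g ⟨a, haI⟩
    refine ⟨{ toFun := fun r => j r * c, map_add' := fun x y => by rw [map_add, add_mul],
              map_smul' := fun x y => by
                rw [smul_eq_mul, map_mul, mul_assoc]; rfl }, fun r hr => ?_⟩
    obtain ⟨s, t, hs, hst⟩ := hR a r ha
    have hjs : j s ≠ 0 := fun h => hs (hj (by rw [h, map_zero]))
    have e1 : j s * g ⟨r, hr⟩ = j t * g ⟨a, haI⟩ := by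
      have h1 : g (s • ⟨r, hr⟩) = j s * g ⟨r, hr⟩ := map_smul g s _
      have h2 : g (t • ⟨a, haI⟩) = j t * g ⟨a, haI⟩ := map_smul g t _
      rw [← h1, ← h2]
      congr 1
      exact Subtype.ext hst
    have e2 : j s * j r = j t * j a := by rw [← map_mul, hst, map_mul]
    apply mul_left_cancel₀ hjs
    change j s * (j r * c) = _
    rw [e1, ← mul_assoc, e2, mul_assoc]
    simp only [c]
    rw [mul_inv_cancel_left₀ hja]
  · push Not at hI
    refine ⟨0, fun r hr => ?_⟩
    obtain rfl := hI r hr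
    exact (map_zero g).symm

include hj hR in
/-- A semilinear map into a skew field of fractions that vanishes on the kernel of `φ` factors
through `φ`. -/
theorem exists_factor_of_ker_le {M M' : Type*} [AddCommGroup M] [AddCommGroup M'] [Module R M]
    [Module R M'] (φ : M →ₗ[R] M') (f : M →ₛₗ[j] K) (h : ∀ m, φ m = 0 → f m = 0) :
    ∃ F : M' →ₛₗ[j] K, ∀ m, F (φ m) = f m := by
  let _ := Module.compHom K j
  let f' : M →ₗ[R] K := { f.toAddMonoidHom with map_smul' := fun r x => map_smulₛₗ f r x }
  let g : (M ⧸ LinearMap.ker φ) →ₗ[R] K := (LinearMap.ker φ).liftQ f' h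
  obtain ⟨F, hF⟩ := (baer_of_leftOre j hj hR).extension_property
    ((LinearMap.ker φ).liftQ φ le_rfl)
    (LinearMap.ker_eq_bot.1 (Submodule.ker_liftQ_eq_bot _ _ _ le_rfl)) g
  refine ⟨{ F.toAddMonoidHom with map_smul' := fun r x => map_smul F r x }, fun m => ?_⟩
  exact LinearMap.congr_fun hF (Submodule.Quotient.mk m)

include hj hR in
/-- A linearly independent family can be sent to arbitrary values by a semilinear map to `K`. -/
theorem exists_semilinear_apply_eq {M I : Type*} [AddCommGroup M] [Module R M] (x : I → M)
    (hx : LinearIndependent R x) (c : I → K) : ∃ F : M →ₛₗ[j] K, ∀ i, F (x i) = c i := by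
  let f : (I →₀ R) →ₛₗ[j] K :=
    { toFun := fun l => l.sum fun i a => j a * c i
      map_add' := fun l l' => Finsupp.sum_add_index' (by simp) (by simp [add_mul])
      map_smul' := fun r l => by
        rw [Finsupp.sum_smul_index' (by simp), smul_eq_mul, Finsupp.mul_sum]
        simp only [smul_eq_mul, map_mul, mul_assoc] }
  obtain ⟨F, hF⟩ := exists_factor_of_ker_le j hj hR (Finsupp.linearCombination R x) f
    (fun m hm => by rw [linearIndependent_iff.1 hx m hm, map_zero])
  refine ⟨F, fun i => ?_⟩
  have := hF (Finsupp.single i 1)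
  simpa [f] using this

end Injective

/-! ### Crossed homomorphisms -/

/-- Crossed homomorphisms (derivations) `D : G → M`, where `G` acts on the left `S`-module `M`
through a homomorphism `ρ` to the multiplicative monoid of `S`. -/
def IsCrossedHom {G S M : Type*} [Group G] [Ring S] [AddCommGroup M] [Module S M] (ρ : G →* S)
    (D : G → M) : Prop :=
  ∀ g h, D (g * h) = D g + ρ g • D h

namespace IsCrossedHom

variable {G S M : Type*} [Group G] [Ring S] [AddCommGroup M] [Module S M] {ρ : G →* S} {D : G → M}

theorem map_one (hD : IsCrossedHom ρ D) : D 1 = 0 := by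
  have := hD 1 1
  rw [mul_one, _root_.map_one, one_smul] at this
  exact left_eq_add.1 this

theorem map_inv (hD : IsCrossedHom ρ D) (g : G) : D g⁻¹ = -(ρ g⁻¹ • D g) := by
  have := hD g⁻¹ g
  rw [inv_mul_cancel, hD.map_one] at this
  exact eq_neg_of_add_eq_zero_left this.symm

theorem map_mul_of_eq_one (hD : IsCrossedHom ρ D) {g : G} (hg : ρ g = 1) (h : G) :
    D (g * h) = D g + D h := by
  rw [hD, hg, one_smul]

theorem map_conj (hD : IsCrossedHom ρ D) (g : G) {x : G} (hx : ρ x = 1) :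
    D (g * x * g⁻¹) = ρ g • D x := by
  rw [hD, hD g x, map_mul, hx, mul_one, hD.map_inv, smul_neg, smul_smul, ← map_mul,
    mul_inv_cancel, _root_.map_one, one_smul]
  abel

theorem comp (hD : IsCrossedHom ρ D) {H : Type*} [Group H] (f : H →* G) :
    IsCrossedHom (ρ.comp f) (D ∘ f) := fun g h => by simp [hD (f g) (f h)]

theorem sub (hD : IsCrossedHom ρ D) {E : G → M} (hE : IsCrossedHom ρ E) :
    IsCrossedHom ρ fun g => D g - E g := fun g h => by
  simp only [hD g h, hE g h, smul_sub]; abel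

theorem inner (ρ : G →* S) (m : M) : IsCrossedHom ρ fun g => ρ g • m - m := fun g h => by
  simp [smul_sub, mul_smul]

/-- A crossed homomorphism is determined by its values on a generating set. -/
theorem eqOn_closure (hD : IsCrossedHom ρ D) {E : G → M} (hE : IsCrossedHom ρ E) {s : Set G}
    (h : ∀ g ∈ s, D g = E g) : ∀ g ∈ Subgroup.closure s, D g = E g := by
  intro g hg
  induction hg using Subgroup.closure_induction with
  | mem x hx => exact h x hx
  | one => rw [hD.map_one, hE.map_one]
  | mul x y _ _ hx hy => rw [hD, hE, hx, hy]
  | inv x _ hx => rw [hD.map_inv, hE.map_inv, hx]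

end IsCrossedHom

/-- On a free group a crossed homomorphism with prescribed values on the generators exists
(for values in a free module on the generators, these are the Fox derivatives). -/
theorem exists_isCrossedHom_freeGroup {X S M : Type*} [Ring S] [AddCommGroup M] [Module S M]
    (ρ : FreeGroup X →* S) (m : X → M) :
    ∃ D : FreeGroup X → M, IsCrossedHom ρ D ∧ ∀ x, D (FreeGroup.of x) = m x := by
  -- The affine maps `v ↦ m x + ρ x • v` define an action of the free group on `M`.
  let σ : X → Equiv.Perm M := fun x =>
    { toFun := fun v => m x + ρ (FreeGroup.of x) • v
      invFun := fun v => ρ (FreeGroup.of x)⁻¹ • (v - m x)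
      left_inv := fun v => by
        simp only [add_sub_cancel_left, smul_smul, ← map_mul, inv_mul_cancel, map_one, one_smul]
      right_inv := fun v => by
        simp only [smul_smul, ← map_mul, mul_inv_cancel, map_one, one_smul, add_sub_cancel] }
  let F : FreeGroup X →* Equiv.Perm M := FreeGroup.lift σ
  have key : ∀ (w : FreeGroup X) (v : M), F w v = F w 0 + ρ w • v := by
    intro w
    induction w using FreeGroup.induction_on with
    | C1 => intro v; simp
    | of x => intro v; simp [F, σ]
    | inv_of x _ =>
      intro v
      have h1 : ∀ v, F (FreeGroup.of x)⁻¹ v = ρ (FreeGroup.of x)⁻¹ • (v - m x) := by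
        intro v
        rw [map_inv, FreeGroup.lift_apply_of]
        rfl
      rw [h1, h1, ← smul_add]
      congr 1; abel
    | mul x y hx hy =>
      intro v
      rw [map_mul, Equiv.Perm.mul_apply, Equiv.Perm.mul_apply, hy v, hx, hx (F y 0), map_mul,
        mul_smul, smul_add]
      abel
  refine ⟨fun w => F w 0, fun g h => ?_, fun x => ?_⟩
  · simp only [map_mul, Equiv.Perm.mul_apply]
    exact key g _
  · simp [F, σ]

/-! ### Left modules from right modules over a group ring -/

/-- The anti-automorphism `g ↦ g⁻¹` of `ℤ[G]`, as a homomorphism to the opposite ring. -/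
noncomputable def groupRingInv (G : Type*) [Group G] :
    MonoidAlgebra ℤ G →+* (MonoidAlgebra ℤ G)ᵐᵒᵖ :=
  (MonoidAlgebra.lift ℤ (MonoidAlgebra ℤ G)ᵐᵒᵖ G
    { toFun := fun g => MulOpposite.op (MonoidAlgebra.single g⁻¹ 1)
      map_one' := by rw [inv_one]; rfl
      map_mul' := fun g h => by
        rw [← MulOpposite.op_mul, MonoidAlgebra.single_mul_single, mul_inv_rev,
          one_mul] }).toRingHom

theorem groupRingInv_single {G : Type*} [Group G] (g : G) (r : ℤ) :
    groupRingInv G (MonoidAlgebra.single g r) = MulOpposite.op (MonoidAlgebra.single g⁻¹ r) := by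
  simp only [groupRingInv, AlgHom.toRingHom_eq_coe, RingHom.coe_coe, MonoidAlgebra.lift_single]
  rw [MonoidHom.coe_mk, OneHom.coe_mk, ← MulOpposite.op_smul, MonoidAlgebra.smul_single,
    smul_eq_mul, mul_one]

theorem groupRingInv_unop {G : Type*} [Group G] (x : MonoidAlgebra ℤ G) :
    groupRingInv G (groupRingInv G x).unop = MulOpposite.op x := by
  induction x using MonoidAlgebra.induction_linear with
  | zero => simp
  | add a b ha hb => simp only [map_add, MulOpposite.unop_add, ha, hb, MulOpposite.op_add]
  | single g r => simp [groupRingInv_single]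

theorem groupRingInv_bijective (G : Type*) [Group G] : Function.Bijective (groupRingInv G) := by
  refine ⟨fun x y h => ?_, fun x => ⟨_, groupRingInv_unop x.unop⟩⟩
  apply MulOpposite.op_injective
  rw [← groupRingInv_unop x, ← groupRingInv_unop y, h]

section ConjQuotLeft

variable {G : Type u} [Group G] (N K' : Subgroup G) [N.Normal] [K'.Normal] (h : ⁅N, N⁆ ≤ K')

/-- The left module structure `g [x] = [g x g⁻¹]` that corresponds to the right module structure
`[x] g = [g⁻¹ x g]`. -/
noncomputable instance ConjQuot.leftModule : Module (MonoidAlgebra ℤ (G ⧸ N)) (ConjQuot N K' h) :=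
  Module.compHom _ (groupRingInv (G ⧸ N))

theorem ConjQuot.leftModule_smul_def (a : MonoidAlgebra ℤ (G ⧸ N)) (m : ConjQuot N K' h) :
    a • m = groupRingInv (G ⧸ N) a • m := rfl

theorem ConjQuot.single_smul_mk (g : G) (r : ℤ) (x : N) :
    (MonoidAlgebra.single (g : G ⧸ N) r : MonoidAlgebra ℤ (G ⧸ N)) • ConjQuot.mk N K' h x =
      r • ConjQuot.mk N K' h (MulAut.conjNormal g x) := by
  rw [ConjQuot.leftModule_smul_def, groupRingInv_single, ← QuotientGroup.mk_inv]
  have : (MonoidAlgebra.single ((g⁻¹ : G) : G ⧸ N) r : MonoidAlgebra ℤ (G ⧸ N)) =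
      r • MonoidAlgebra.of ℤ (G ⧸ N) ((g⁻¹ : G) : G ⧸ N) := by simp
  rw [this, MulOpposite.op_smul]
  have h2 := ConjQuot.mk_smul_of N K' h g⁻¹ x
  rw [inv_inv] at h2
  rw [← h2, smul_assoc]

theorem ConjQuot.mk_mul (x y : N) :
    ConjQuot.mk N K' h (x * y) = ConjQuot.mk N K' h x + ConjQuot.mk N K' h y := rfl

/-- The definition of `torsionPreimage` in terms of the left module structure. -/
theorem mem_torsionPreimage_iff (y : G) :
    y ∈ torsionPreimage N ↔ ∃ x : N, (x : G) = y ∧ ∃ γ : MonoidAlgebra ℤ (G ⧸ N), γ ≠ 0 ∧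
      γ • ConjQuot.mk N ⁅N, N⁆ le_rfl x = 0 := by
  have h0 : ∀ γ, groupRingInv (G ⧸ N) γ = 0 ↔ γ = 0 := fun γ =>
    map_eq_zero_iff _ (groupRingInv_bijective _).1
  constructor
  · rintro ⟨x, hx, γ, hγ, hxγ⟩
    obtain ⟨γ', hγ'⟩ := (groupRingInv_bijective (G ⧸ N)).2 (MulOpposite.op γ)
    refine ⟨x, hx, γ', fun h => hγ ?_, ?_⟩
    · rw [h, map_zero] at hγ'
      exact (MulOpposite.op_eq_zero_iff γ).1 hγ'.symm
    · rw [ConjQuot.leftModule_smul_def, hγ', hxγ]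
  · rintro ⟨x, hx, γ, hγ, hxγ⟩
    refine ⟨x, hx, (groupRingInv _ γ).unop, fun h => hγ ?_, ?_⟩
    · exact (h0 γ).1 ((MulOpposite.unop_eq_zero_iff _).1 h)
    · rw [MulOpposite.op_unop]; exact hxγ

end ConjQuotLeft

/-- The additive map on `ℤ[Q]` with prescribed values on the elements of `Q`. -/
noncomputable def groupRingSum {Q M : Type*} [AddCommGroup M] (f : Q → M) :
    MonoidAlgebra ℤ Q →+ M :=
  (Finsupp.liftAddHom fun q : Q => (smulAddHom ℤ M).flip (f q)).comp
    (MonoidAlgebra.coeffAddEquiv (R := ℤ) (M := Q)).toAddMonoidHom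

theorem groupRingSum_single {Q M : Type*} [AddCommGroup M] (f : Q → M) (q : Q) (r : ℤ) :
    groupRingSum f (MonoidAlgebra.single q r) = r • f q := by
  simp [groupRingSum]

/-! ### Crossed homomorphisms and the modules `N/K'` -/

/-- The action of `B` on a ring `K` through homomorphisms `B → Γ` and `ℤ[Γ] → K`. -/
noncomputable abbrev ringAction {B Γ K : Type*} [Group B] [Group Γ] [Ring K] (π : B →* Γ)
    (j : MonoidAlgebra ℤ Γ →+* K) : B →* K :=
  ((j : MonoidAlgebra ℤ Γ →* K).comp (MonoidAlgebra.of ℤ Γ)).comp π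

theorem torsionStep_le {G : Type u} [Group G] (N : Subgroup G) [N.Normal] : torsionStep N ≤ N :=
  (Subgroup.closure_le _).2 fun y hy => by
    obtain ⟨x, rfl, -⟩ := hy; exact x.2

section CrossedConj

variable {G : Type u} [Group G] (N K' : Subgroup G) [N.Normal] [K'.Normal] (h : ⁅N, N⁆ ≤ K')
  {K : Type*} [DivisionRing K] (j : MonoidAlgebra ℤ (G ⧸ N) →+* K)

/-- The action of `G` on `K` through a homomorphism `ℤ[G/N] → K`. -/
noncomputable def quotAction : G →* K := ringAction (QuotientGroup.mk' N) j

theorem quotAction_apply (g : G) :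
    quotAction N j g = j (MonoidAlgebra.single (g : G ⧸ N) 1) := rfl

theorem quotAction_eq_one {x : G} (hx : x ∈ N) : quotAction N j x = 1 := by
  rw [quotAction_apply, (QuotientGroup.eq_one_iff x).2 hx]
  exact map_one j

variable {N j}

/-- The restriction of a crossed homomorphism to the subgroup `N`, which acts trivially. -/
def IsCrossedHom.restrictHom {D : G → K} (hD : IsCrossedHom (quotAction N j) D) :
    N →* Multiplicative K where
  toFun x := Multiplicative.ofAdd (D x)
  map_one' := by simp [hD.map_one]
  map_mul' x y := by
    rw [Subgroup.coe_mul, hD.map_mul_of_eq_one (quotAction_eq_one N j x.2)]; rfl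

/-- A crossed homomorphism that vanishes on `K'` restricts to a linear map on `N/K'`. -/
theorem exists_semilinear_of_isCrossedHom {D : G → K} (hD : IsCrossedHom (quotAction N j) D)
    (hK' : ∀ x ∈ N, x ∈ K' → D x = 0) :
    ∃ F : ConjQuot N K' h →ₛₗ[j] K, ∀ x : N, F (ConjQuot.mk N K' h x) = D x := by
  let F1 : N ⧸ K'.subgroupOf N →* Multiplicative K := QuotientGroup.lift _ hD.restrictHom
    fun x hx => hK' x x.2 (Subgroup.mem_subgroupOf.1 hx)
  let F2 : ConjQuot N K' h →+ K := MonoidHom.toAdditiveLeft F1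
  have hF2 : ∀ x : N, F2 (ConjQuot.mk N K' h x) = D x := fun x => rfl
  refine ⟨{ F2 with map_smul' := fun a m => ?_ }, hF2⟩
  change F2 (a • m) = j a • F2 m
  obtain ⟨x, rfl⟩ := ConjQuot.mk_surjective N K' h m
  induction a using MonoidAlgebra.induction_linear with
  | zero => simp
  | add a b ha hb => rw [add_smul, map_add, ha, hb, map_add, add_smul]
  | single q r =>
    obtain ⟨g, rfl⟩ := QuotientGroup.mk_surjective q
    rw [ConjQuot.single_smul_mk, map_zsmul, hF2, hF2, MulAut.conjNormal_apply,
      hD.map_conj g (quotAction_eq_one N j x.2), quotAction_apply]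
    have : (MonoidAlgebra.single (g : G ⧸ N) r : MonoidAlgebra ℤ (G ⧸ N)) =
      r • MonoidAlgebra.single (g : G ⧸ N) 1 := by simp
    rw [this, map_zsmul, smul_assoc]

/-- Crossed homomorphisms with values in a skew field containing `ℤ[G/N]` vanish on the elements
of `N` that are torsion in `N/[N, N]`. -/
theorem IsCrossedHom.eq_zero_of_mem_torsionStep {D : G → K} (hj : Function.Injective j)
    (hD : IsCrossedHom (quotAction N j) D) {x : G} (hx : x ∈ torsionStep N) : D x = 0 := by
  have hcomm : ∀ x ∈ N, x ∈ ⁅N, N⁆ → D x = 0 := by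
    intro x _ hx
    have h1 : (commutator N).map N.subtype = ⁅N, N⁆ := by
      rw [commutator_def, Subgroup.map_commutator, ← MonoidHom.range_eq_map,
        Subgroup.range_subtype]
    rw [← h1] at hx
    obtain ⟨y, hy, rfl⟩ := hx
    exact Abelianization.commutator_subset_ker hD.restrictHom hy
  obtain ⟨F, hF⟩ := exists_semilinear_of_isCrossedHom ⁅N, N⁆ le_rfl hD hcomm
  have key : torsionStep N ≤ N ∧ ∀ x ∈ torsionStep N, D x = 0 := by
    have hle := torsionStep_le N
    refine ⟨hle, fun x hx => ?_⟩
    induction hx using Subgroup.closure_induction with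
    | mem y hy =>
      obtain ⟨x, rfl, γ, hγ, h0⟩ := (mem_torsionPreimage_iff N y).1 hy
      have := congrArg F h0
      rw [map_smulₛₗ, map_zero, hF, smul_eq_mul] at this
      exact (mul_eq_zero.1 this).resolve_left fun h => hγ (hj (by rw [h, map_zero]))
    | one => exact hD.map_one
    | mul a b ha _ iha ihb =>
      rw [hD.map_mul_of_eq_one (quotAction_eq_one N j (hle ha)), iha, ihb, add_zero]
    | inv a _ iha => rw [hD.map_inv, iha, smul_zero, neg_zero]
  exact key.2 x hx

/-- Every linear map from `N/K'` to the skew field `K` is the restriction of a crossed homomorphism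
on `G`. This holds since `K` is injective, and since `N/K'` embeds into the module that carries the
universal crossed homomorphism (the Magnus embedding). -/
theorem exists_isCrossedHom_of_semilinear (hj : Function.Injective j)
    (hR : LeftOre (MonoidAlgebra ℤ (G ⧸ N))) (f : ConjQuot N K' h →ₛₗ[j] K) :
    ∃ D : G → K, IsCrossedHom (quotAction N j) D ∧
      ∀ x : N, D x = f (ConjQuot.mk N K' h x) := by
  -- A section `s` defines a retraction `c : G → N`, and `θ` is the induced additive map from the
  -- free module on `G` to `N/K'`. It is linear on the submodule `W`, which contains the basis
  -- vectors of `N` and the relations that define crossed homomorphisms, and `θ` vanishes on the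
  -- latter. An extension of `f ∘ θ` from `W` to the free module is the crossed homomorphism.
  let s : G ⧸ N → G := Quotient.out
  have hs : ∀ q, ((s q : G) : G ⧸ N) = q := fun q => QuotientGroup.out_eq' q
  let c : G → N := fun g => ⟨g * (s (g : G ⧸ N))⁻¹, by
    rw [← QuotientGroup.eq_one_iff, QuotientGroup.mk_mul, QuotientGroup.mk_inv, hs,
      mul_inv_cancel]⟩
  let θ₀ : G → MonoidAlgebra ℤ (G ⧸ N) →+ ConjQuot N K' h := fun g =>
    groupRingSum fun q : G ⧸ N => ConjQuot.mk N K' h (c (s q * g))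
  let θ : (G →₀ MonoidAlgebra ℤ (G ⧸ N)) →+ ConjQuot N K' h := Finsupp.liftAddHom θ₀
  have hθ : ∀ (g : G) (q : G ⧸ N) (r : ℤ), θ (Finsupp.single g (MonoidAlgebra.single q r)) =
      r • ConjQuot.mk N K' h (c (s q * g)) := by
    intro g q r
    simp only [θ, θ₀, Finsupp.liftAddHom_apply_single, groupRingSum_single]
  let W : Submodule (MonoidAlgebra ℤ (G ⧸ N)) (G →₀ MonoidAlgebra ℤ (G ⧸ N)) :=
    { carrier := {w | ∀ a : MonoidAlgebra ℤ (G ⧸ N), θ (a • w) = a • θ w}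
      add_mem' := fun {x y} hx hy a => by rw [smul_add, map_add, map_add, smul_add, hx a, hy a]
      zero_mem' := fun a => by simp
      smul_mem' := fun b w hw a => by rw [smul_smul, hw (a * b), hw b, smul_smul] }
  let g' : W →ₛₗ[j] K :=
    { toFun := fun w => f (θ w)
      map_add' := fun x y => by rw [Submodule.coe_add, map_add, map_add]
      map_smul' := fun a w => by rw [Submodule.coe_smul, w.2 a, map_smulₛₗ] }
  obtain ⟨F, hF⟩ := exists_factor_of_ker_le (M := W) j hj hR W.subtype g' fun m hm => by
    rw [Submodule.subtype_apply, Submodule.coe_eq_zero] at hm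
    rw [hm, map_zero]
  have hF' : ∀ w (hw : w ∈ W), F w = f (θ w) := fun w hw => hF ⟨w, hw⟩
  have hx : ∀ (x : N) (q : G ⧸ N) (r : ℤ),
      θ (Finsupp.single (x : G) (MonoidAlgebra.single q r)) =
        (MonoidAlgebra.single q r : MonoidAlgebra ℤ (G ⧸ N)) • ConjQuot.mk N K' h x := by
    intro x q r
    have e : c (s q * x) = MulAut.conjNormal (s q) x := by
      ext
      have : ((s q * x : G) : G ⧸ N) = q := by
        rw [QuotientGroup.mk_mul, hs, (QuotientGroup.eq_one_iff (x : G)).2 x.2, mul_one]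
      simp only [c, this, MulAut.conjNormal_apply]
    have h3 := ConjQuot.single_smul_mk N K' h (s q) r x
    rw [hs q] at h3
    rw [hθ, e, h3]
  have hx1 : ∀ x : N, θ (Finsupp.single (x : G) 1) = ConjQuot.mk N K' h x := by
    intro x
    have := hx x 1 1
    rw [← MonoidAlgebra.one_def, one_smul] at this
    exact this
  have hxW : ∀ x : N, Finsupp.single (x : G) (1 : MonoidAlgebra ℤ (G ⧸ N)) ∈ W := by
    intro x a
    rw [hx1, Finsupp.smul_single, smul_eq_mul, mul_one]
    induction a using MonoidAlgebra.induction_linear with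
    | zero => simp
    | add a b ha hb => rw [Finsupp.single_add, map_add, ha, hb, add_smul]
    | single q r => exact hx x q r
  have hrel : ∀ (g g₁ : G) (a : MonoidAlgebra ℤ (G ⧸ N)),
      θ (a • (Finsupp.single (g * g₁) 1 - Finsupp.single g 1 -
        Finsupp.single g₁ (MonoidAlgebra.single (g : G ⧸ N) 1))) = 0 := by
    intro g g₁ a
    induction a using MonoidAlgebra.induction_linear with
    | zero => simp
    | add a b ha hb => rw [add_smul, map_add, ha, hb, add_zero]
    | single q r =>
      simp only [smul_sub, Finsupp.smul_single, smul_eq_mul, mul_one,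
        MonoidAlgebra.single_mul_single, map_sub, hθ]
      rw [← smul_sub, ← smul_sub]
      have e : c (s q * (g * g₁)) = c (s q * g) * c (s (q * g) * g₁) := by
        ext
        have e1 : ((s q * g : G) : G ⧸ N) = q * (g : G ⧸ N) := by
          rw [QuotientGroup.mk_mul, hs]
        have e2 : ((s (q * (g : G ⧸ N)) * g₁ : G) : G ⧸ N) = q * g * g₁ := by
          rw [QuotientGroup.mk_mul, hs]
        have e3 : ((s q * (g * g₁) : G) : G ⧸ N) = q * g * g₁ := by
          rw [QuotientGroup.mk_mul, QuotientGroup.mk_mul, hs, mul_assoc]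
        simp only [c, Subgroup.coe_mul, e1, e2, e3]
        group
      rw [e, ConjQuot.mk_mul]
      simp
  refine ⟨fun g => F (Finsupp.single g 1), fun g g₁ => ?_, fun x => ?_⟩
  · have hw : (Finsupp.single (g * g₁) 1 - Finsupp.single g 1 -
        Finsupp.single g₁ (MonoidAlgebra.single (g : G ⧸ N) 1) :
          (G →₀ MonoidAlgebra ℤ (G ⧸ N))) ∈ W := fun a => by
        have := hrel g g₁ 1
        rw [one_smul] at this
        rw [hrel, this, smul_zero]
    have h1 := hF' _ hw
    have h2 := hrel g g₁ 1
    rw [one_smul] at h2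
    have h3 : Finsupp.single g₁ (MonoidAlgebra.single (g : G ⧸ N) 1 : MonoidAlgebra ℤ (G ⧸ N)) =
        (MonoidAlgebra.single (g : G ⧸ N) 1 : MonoidAlgebra ℤ (G ⧸ N)) •
          Finsupp.single g₁ (1 : MonoidAlgebra ℤ (G ⧸ N)) := by simp
    rw [h2, map_zero, map_sub, map_sub, h3, map_smulₛₗ, sub_sub, sub_eq_zero] at h1
    exact h1
  · change F (Finsupp.single (x : G) 1) = _
    rw [hF' _ (hxW x), hx1]

/-- Elements of `N` that are not torsion in `N/[N, N]` are detected by crossed homomorphisms. -/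
theorem exists_isCrossedHom_ne_zero (hj : Function.Injective j)
    (hR : LeftOre (MonoidAlgebra ℤ (G ⧸ N))) {x : G} (hxN : x ∈ N) (hx : x ∉ torsionPreimage N) :
    ∃ D : G → K, IsCrossedHom (quotAction N j) D ∧ D x ≠ 0 := by
  have hind : LinearIndependent (MonoidAlgebra ℤ (G ⧸ N))
      fun _ : Unit => ConjQuot.mk N ⁅N, N⁆ le_rfl ⟨x, hxN⟩ := by
    rw [Fintype.linearIndependent_iff]
    intro a ha i
    by_contra hne
    refine hx ((mem_torsionPreimage_iff N x).2 ⟨⟨x, hxN⟩, rfl, a i, hne, ?_⟩)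
    simpa using ha
  obtain ⟨f, hf⟩ := exists_semilinear_apply_eq j hj hR _ hind fun _ => 1
  obtain ⟨D, hD, hDf⟩ := exists_isCrossedHom_of_semilinear ⁅N, N⁆ le_rfl hj hR f
  refine ⟨D, hD, ?_⟩
  rw [hDf ⟨x, hxN⟩, hf ()]
  exact one_ne_zero

/-- Crossed homomorphisms that vanish on `N` are inner: they come from linear maps on the
augmentation ideal of `ℤ[G/N]`, and such a map is a right multiplication. -/
theorem IsCrossedHom.exists_inner {D : G → K} (hj : Function.Injective j)
    (hR : LeftOre (MonoidAlgebra ℤ (G ⧸ N))) (hD : IsCrossedHom (quotAction N j) D)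
    (hN : ∀ x ∈ N, D x = 0) : ∃ k : K, ∀ g, D g = quotAction N j g • k - k := by
  by_cases hall : ∀ g, g ∈ N
  · refine ⟨0, fun g => ?_⟩
    rw [hN g (hall g)]; simp
  push Not at hall
  obtain ⟨g₀, hg₀⟩ := hall
  let s : G ⧸ N → G := Quotient.out
  have hs : ∀ q, ((s q : G) : G ⧸ N) = q := fun q => QuotientGroup.out_eq' q
  have hDN : ∀ g g' : G, (g : G ⧸ N) = g' → D g = D g' := by
    intro g g' hgg
    have hm : g⁻¹ * g' ∈ N := QuotientGroup.eq.1 hgg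
    have := hD g (g⁻¹ * g')
    rw [mul_inv_cancel_left, hN _ hm, smul_zero, add_zero] at this
    exact this.symm
  let L : MonoidAlgebra ℤ (G ⧸ N) →+ K := groupRingSum fun q : G ⧸ N => D (s q)
  have hL : ∀ (q : G ⧸ N) (r : ℤ), L (MonoidAlgebra.single q r) = r • D (s q) := by
    intro q r; rw [groupRingSum_single]
  have key : ∀ (g : G) (a : MonoidAlgebra ℤ (G ⧸ N)),
      L (a * (MonoidAlgebra.single (g : G ⧸ N) 1 - 1)) = j a * D g := by
    intro g a
    induction a using MonoidAlgebra.induction_linear with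
    | zero => simp
    | add a b ha hb => rw [add_mul, map_add, ha, hb, map_add, add_mul]
    | single q r =>
      rw [mul_sub, mul_one, MonoidAlgebra.single_mul_single, mul_one, map_sub, hL, hL,
        hDN (s (q * g)) (s q * g) (by rw [QuotientGroup.mk_mul, hs, hs]), hD,
        quotAction_apply, hs]
      have : (MonoidAlgebra.single q r : MonoidAlgebra ℤ (G ⧸ N)) =
          r • MonoidAlgebra.single q 1 := by simp
      rw [this, map_zsmul, smul_add, add_sub_cancel_left, smul_eq_mul, smul_mul_assoc]
  let u₀ : MonoidAlgebra ℤ (G ⧸ N) := MonoidAlgebra.single (g₀ : G ⧸ N) 1 - 1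
  have hu₀ : u₀ ≠ 0 := by
    intro h0
    have h1 : (MonoidAlgebra.single (g₀ : G ⧸ N) 1 : MonoidAlgebra ℤ (G ⧸ N)) =
        MonoidAlgebra.single 1 1 := sub_eq_zero.1 h0
    exact hg₀ ((QuotientGroup.eq_one_iff g₀).1 (MonoidAlgebra.of_injective (R := ℤ) h1))
  have hju₀ : j u₀ ≠ 0 := fun h => hu₀ (hj (by rw [h, map_zero]))
  refine ⟨(j u₀)⁻¹ * D g₀, fun g => ?_⟩
  obtain ⟨a, b, ha, hab⟩ := hR u₀ (MonoidAlgebra.single (g : G ⧸ N) 1 - 1) hu₀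
  have hja : j a ≠ 0 := fun h => ha (hj (by rw [h, map_zero]))
  apply mul_left_cancel₀ hja
  have e1 := key g a
  rw [hab, key g₀ b] at e1
  have e2 : j b = j a * j (MonoidAlgebra.single (g : G ⧸ N) 1 - 1) * (j u₀)⁻¹ := by
    rw [← map_mul, hab, map_mul, mul_assoc, mul_inv_cancel₀ hju₀, mul_one]
  rw [← e1, e2, quotAction_apply, map_sub, _root_.map_one, smul_eq_mul]
  simp only [mul_sub, sub_mul, mul_assoc, mul_one]

end CrossedConj

/-! ### The quotients by the torsion-free derived series -/

theorem tfDerived_succ_le (G : Type u) [Group G] (n : ℕ) : tfDerived G (n + 1) ≤ tfDerived G n :=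
  torsionStep_le (tfDerived G n)

theorem tfDerived_antitone (G : Type u) [Group G] : Antitone (tfDerived G) :=
  antitone_nat_of_succ_le (tfDerived_succ_le G)

theorem derivedSeries_le_tfDerived (G : Type u) [Group G] (n : ℕ) :
    derivedSeries G n ≤ tfDerived G n := by
  induction n with
  | zero => exact le_top
  | succ n ih =>
    rw [derivedSeries_succ]
    exact (Subgroup.commutator_mono ih ih).trans (commutator_tfDerived_le G n)

theorem derivedSeries_quot_tfDerived (G : Type u) [Group G] (n : ℕ) :
    derivedSeries (G ⧸ tfDerived G n) n = ⊥ := by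
  rw [← map_derivedSeries_eq (f := QuotientGroup.mk' (tfDerived G n))
    (QuotientGroup.mk'_surjective _), eq_bot_iff, Subgroup.map_le_iff_le_comap]
  intro x hx
  rw [Subgroup.mem_comap, Subgroup.mem_bot]
  exact (QuotientGroup.eq_one_iff x).2 (derivedSeries_le_tfDerived G n hx)

instance strongRankCondition_tfDerived (G : Type u) [Group G] (n : ℕ) :
    StrongRankCondition (MonoidAlgebra ℤ (G ⧸ tfDerived G n)) :=
  strongRankCondition_of_derivedSeries_eq_bot n _ (derivedSeries_quot_tfDerived G n)

theorem intCast_ne_zero_of_embedding {Γ K : Type*} [Group Γ] [DivisionRing K]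
    {j : MonoidAlgebra ℤ Γ →+* K} (hj : Function.Injective j) {n : ℕ} (hn : n ≠ 0) :
    (n : K) ≠ 0 := by
  rw [← map_natCast j n]
  intro h
  have h1 : (n : MonoidAlgebra ℤ Γ) = 0 := hj (by rw [h, map_zero])
  have h2 := congrArg (augm Γ) h1
  rw [map_natCast, map_zero] at h2
  exact hn (by exact_mod_cast h2)

/-- Crossed homomorphisms into a skew field detect the next term of the torsion-free series. -/
theorem mem_torsionStep_of_forall {G : Type u} [Group G] {N : Subgroup G} [N.Normal] {K : Type u}
    [DivisionRing K] {j : MonoidAlgebra ℤ (G ⧸ N) →+* K} (hj : Function.Injective j)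
    (hR : LeftOre (MonoidAlgebra ℤ (G ⧸ N))) {x : G} (hxN : x ∈ N)
    (hx : ∀ D : G → K, IsCrossedHom (quotAction N j) D → D x = 0) : x ∈ torsionStep N := by
  by_contra hne
  obtain ⟨D, hD, hDx⟩ := exists_isCrossedHom_ne_zero hj hR hxN
    fun h => hne (Subgroup.subset_closure h)
  exact hDx (hx D hD)

/-- The quotient of `N` by the next term is torsion-free as a group. -/
theorem pow_mem_torsionStep {G : Type u} [Group G] {N : Subgroup G} [N.Normal]
    [IsDomain (MonoidAlgebra ℤ (G ⧸ N))] [StrongRankCondition (MonoidAlgebra ℤ (G ⧸ N))] {x : G}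
    (hxN : x ∈ N) {n : ℕ} (hn : n ≠ 0) (hx : x ^ n ∈ torsionStep N) : x ∈ torsionStep N := by
  obtain ⟨K, _, j, hj⟩ := exists_divisionRing_embedding (MonoidAlgebra ℤ (G ⧸ N))
  refine mem_torsionStep_of_forall hj (leftOre_of_strongRankCondition _) hxN fun D hD => ?_
  have key : ∀ k : ℕ, D (x ^ k) = k * D x := by
    intro k
    induction k with
    | zero => simp [hD.map_one]
    | succ k ih =>
      rw [pow_succ, hD.map_mul_of_eq_one (quotAction_eq_one N j (N.pow_mem hxN k)), ih]
      rw [Nat.cast_succ, add_mul, one_mul]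
  have h0 := hD.eq_zero_of_mem_torsionStep hj hx
  rw [key] at h0
  exact (mul_eq_zero.1 h0).resolve_left (intCast_ne_zero_of_embedding hj hn)

/-- The two properties are proved together along the extensions of `G/G^{(n)}_H` by the torsion-free
abelian groups `G^{(n)}_H/G^{(n+1)}_H`. -/
theorem tfDerived_quot_properties (G : Type u) [Group G] (n : ℕ) :
    UniqueProds (G ⧸ tfDerived G n) ∧ AugmentationDetects (G ⧸ tfDerived G n) := by
  induction n with
  | zero =>
    have : Subsingleton (G ⧸ tfDerived G 0) := by
      rw [tfDerived_zero]; exact QuotientGroup.subsingleton_quotient_top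
    refine ⟨uniqueProds_of_torsionFree (fun _ _ => Subsingleton.elim _ _)
      fun _ _ _ _ => Subsingleton.elim _ _, AugmentationDetects.of_subsingleton _⟩
  | succ n ih =>
    obtain ⟨h1, h2⟩ := ih
    let π : G ⧸ tfDerived G (n + 1) →* G ⧸ tfDerived G n :=
      QuotientGroup.map _ _ (MonoidHom.id G) (tfDerived_succ_le G n)
    have hπ : Function.Surjective π := fun q => by
      obtain ⟨g, rfl⟩ := QuotientGroup.mk_surjective q
      exact ⟨(g : G ⧸ tfDerived G (n + 1)), rfl⟩
    have hker : ∀ a : π.ker, ∃ x ∈ tfDerived G n, (x : G ⧸ tfDerived G (n + 1)) = a := by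
      rintro ⟨a, ha⟩
      obtain ⟨x, rfl⟩ := QuotientGroup.mk_surjective a
      exact ⟨x, (QuotientGroup.eq_one_iff x).1 ha, rfl⟩
    have hc : ∀ a b : π.ker, a * b = b * a := by
      intro a b
      obtain ⟨x, hx, hxa⟩ := hker a
      obtain ⟨y, hy, hyb⟩ := hker b
      apply Subtype.ext
      rw [Subgroup.coe_mul, Subgroup.coe_mul, ← hxa, ← hyb, ← QuotientGroup.mk_mul,
        ← QuotientGroup.mk_mul, QuotientGroup.eq]
      apply commutator_tfDerived_le G n
      have : (x * y)⁻¹ * (y * x) = ⁅y⁻¹, x⁻¹⁆ := by simp [commutatorElement_def, mul_assoc]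
      rw [this]
      exact Subgroup.commutator_mem_commutator (inv_mem hy) (inv_mem hx)
    have ht : ∀ (a : π.ker) (k : ℕ), k ≠ 0 → a ^ k = 1 → a = 1 := by
      intro a k hk hak
      obtain ⟨x, hx, hxa⟩ := hker a
      have e : (x : G ⧸ tfDerived G (n + 1)) ^ k = 1 := by
        rw [hxa]; exact congrArg Subtype.val hak
      rw [← QuotientGroup.mk_pow, QuotientGroup.eq_one_iff] at e
      apply Subtype.ext
      rw [← hxa, Subgroup.coe_one, QuotientGroup.eq_one_iff]
      exact pow_mem_torsionStep (N := tfDerived G n) hx hk e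
    have h3 : UniqueProds π.ker := uniqueProds_of_torsionFree hc ht
    exact ⟨UniqueProds.of_ker π, AugmentationDetects.of_extension π hπ hc h2⟩

instance isDomain_tfDerived (G : Type u) [Group G] (n : ℕ) :
    IsDomain (MonoidAlgebra ℤ (G ⧸ tfDerived G n)) :=
  have := (tfDerived_quot_properties G n).1
  inferInstance

theorem augmentationDetects_tfDerived (G : Type u) [Group G] (n : ℕ) :
    AugmentationDetects (G ⧸ tfDerived G n) :=
  (tfDerived_quot_properties G n).2

theorem leftOre_tfDerived (G : Type u) [Group G] (n : ℕ) :
    LeftOre (MonoidAlgebra ℤ (G ⧸ tfDerived G n)) :=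
  leftOre_of_strongRankCondition _

/-! ### Low-dimensional rational homology through its linear functionals -/

theorem leftOre_of_divisionRing (k : Type*) [DivisionRing k] : LeftOre k := fun a b ha =>
  ⟨1, b * a⁻¹, one_ne_zero, by rw [one_mul, inv_mul_cancel_right₀ ha]⟩

/-- A linear map to a field that vanishes on the kernel of `p` factors through `p`. -/
theorem exists_linear_factor {k V W : Type*} [Field k] [AddCommGroup V] [AddCommGroup W]
    [Module k V] [Module k W] (p : V →ₗ[k] W) (f : V →ₗ[k] k) (h : ∀ v, p v = 0 → f v = 0) :
    ∃ F : W →ₗ[k] k, ∀ v, F (p v) = f v :=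
  exists_factor_of_ker_le (RingHom.id k) Function.injective_id (leftOre_of_divisionRing k) p f h

section Evaluation

/-- The linear functional on rational chains given by a function on the basis. -/
noncomputable def chainEval {X : Type u} (χ : X → ℚ) :
    (X →₀ ULift.{u} ℚ) →ₗ[ULift.{u} ℚ] ULift.{u} ℚ :=
  Finsupp.linearCombination (ULift.{u} ℚ) fun x => ULift.up (χ x)

theorem chainEval_single {X : Type u} (χ : X → ℚ) (x : X) (a : ULift.{u} ℚ) :
    chainEval χ (Finsupp.single x a) = a * ULift.up (χ x) := by
  simp [chainEval]

theorem chainEval_zero {X : Type u} (c : X →₀ ULift.{u} ℚ) :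
    chainEval (fun _ : X => (0 : ℚ)) c = 0 := by
  rw [chainEval, Finsupp.linearCombination_apply]
  exact Finset.sum_eq_zero fun x _ => mul_zero _

/-- Functions with coboundary `α` evaluate on boundaries like `α` on chains. -/
theorem chainEval_d21 {G : Type u} [Group G] (α : G × G → ℚ) (β : G → ℚ)
    (h : ∀ a b, α (a, b) = β a + β b - β (a * b)) (c : G × G →₀ ULift.{u} ℚ) :
    chainEval β (groupHomology.d₂₁ (trivialCoeff ℚ G) c) = chainEval α c := by
  induction c using Finsupp.induction_linear with
  | zero => simp
  | add f g hf hg => rw [map_add, map_add, hf, hg, map_add]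
  | single g a =>
    rw [groupHomology.d₂₁_single, map_add, map_sub]
    erw [chainEval_single, chainEval_single, chainEval_single, chainEval_single]
    rw [h]
    ext
    change a.down * β g.2 - a.down * β (g.1 * g.2) + a.down * β g.1 =
      a.down * (β g.1 + β g.2 - β (g.1 * g.2))
    ring

/-- Cocycles vanish on boundaries. -/
theorem chainEval_d32 {G : Type u} [Group G] (α : G × G → ℚ)
    (h : ∀ a b c, α (a, b) + α (a * b, c) = α (b, c) + α (a, b * c))
    (c : G × G × G →₀ ULift.{u} ℚ) :
    chainEval α (groupHomology.d₃₂ (trivialCoeff ℚ G) c) = 0 := by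
  induction c using Finsupp.induction_linear with
  | zero => simp
  | add f g hf hg => rw [map_add, map_add, hf, hg, add_zero]
  | single g a =>
    rw [groupHomology.d₃₂_single, map_sub, map_add, map_sub]
    erw [chainEval_single, chainEval_single, chainEval_single, chainEval_single]
    ext
    change a.down * α (g.2.1, g.2.2) - a.down * α (g.1 * g.2.1, g.2.2) +
      a.down * α (g.1, g.2.1 * g.2.2) - a.down * α (g.1, g.2.1) = 0
    have := h g.1 g.2.1 g.2.2
    linear_combination (-a.down) * this

end Evaluation

section H1

variable {A B : Type u} [Group A] [Group B] (φ : A →* B)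

theorem cycles₁_mem (c : A →₀ ULift.{u} ℚ) : c ∈ groupHomology.cycles₁ (trivialCoeff ℚ A) := by
  rw [groupHomology.cycles₁_eq_top_of_isTrivial]; trivial

/-- The class in `H_1` of a rational 1-chain. -/
noncomputable def H1class (A : Type u) [Group A] :
    (A →₀ ULift.{u} ℚ) →ₗ[ULift.{u} ℚ] Hlgy ℚ A 1 :=
  (groupHomology.H1π (trivialCoeff ℚ A)).hom ∘ₗ
    { toFun := fun c => ⟨c, cycles₁_mem c⟩
      map_add' := fun _ _ => rfl
      map_smul' := fun _ _ => rfl }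

theorem H1class_eq_zero_iff (c : A →₀ ULift.{u} ℚ) :
    H1class A c = 0 ↔ ∃ e, groupHomology.d₂₁ (trivialCoeff ℚ A) e = c :=
  groupHomology.H1π_eq_zero_iff (A := trivialCoeff ℚ A) ⟨c, cycles₁_mem c⟩

theorem H1class_surjective : Function.Surjective (H1class A) := fun x => by
  obtain ⟨c, rfl⟩ := (ModuleCat.epi_iff_surjective (groupHomology.H1π (trivialCoeff ℚ A))).1
    inferInstance x
  exact ⟨c.1, rfl⟩

theorem map_H1class (c : A →₀ ULift.{u} ℚ) :
    Hlgy.map ℚ φ 1 (H1class A c) = H1class B (Finsupp.mapDomain φ c) := by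
  have := groupHomology.H1π_comp_map_apply (A := trivialCoeff ℚ A) (B := trivialCoeff ℚ B) φ
    (𝟙 (trivialCoeff ℚ A)) ⟨c, cycles₁_mem c⟩
  refine this.trans ?_
  change groupHomology.H1π _ _ = groupHomology.H1π _ _
  congr 1
  apply Subtype.ext
  exact Finsupp.ext fun _ => rfl

theorem H1class_single_mul (a b : A) :
    H1class A (Finsupp.single (a * b) 1) =
      H1class A (Finsupp.single a 1) + H1class A (Finsupp.single b 1) := by
  rw [← map_add, ← sub_eq_zero, ← map_sub, H1class_eq_zero_iff]
  refine ⟨-Finsupp.single (a, b) 1, ?_⟩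
  rw [map_neg, groupHomology.d₂₁_single]
  change -(Finsupp.single b 1 - Finsupp.single (a * b) 1 + Finsupp.single a 1) = _
  abel

/-- If `φ` is injective on `H_1(-; ℚ)`, then additive functions on `A` extend along `φ`. -/
theorem exists_extension_of_H1_injective (hφ : Function.Injective (Hlgy.map ℚ φ 1)) (χ : A → ℚ)
    (hχ : ∀ a b, χ (a * b) = χ a + χ b) :
    ∃ h : B → ℚ, (∀ a b, h (a * b) = h a + h b) ∧ ∀ a, h (φ a) = χ a := by
  obtain ⟨F, hF⟩ := exists_linear_factor (Hlgy.map ℚ φ 1 ∘ₗ H1class A) (chainEval χ) (by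
    intro c hc
    have h0 : H1class A c = 0 := hφ (by rw [map_zero]; exact hc)
    obtain ⟨e, rfl⟩ := (H1class_eq_zero_iff c).1 h0
    rw [chainEval_d21 (fun _ => 0) χ (fun a b => by rw [hχ]; ring), chainEval_zero])
  refine ⟨fun b => (F (H1class B (Finsupp.single b 1))).down, fun a b => ?_, fun a => ?_⟩
  · simp only [H1class_single_mul, map_add]; rfl
  · have := hF (Finsupp.single a 1)
    rw [LinearMap.comp_apply, map_H1class, Finsupp.mapDomain_single, chainEval_single,
      one_mul] at this
    exact congrArg ULift.down this

/-- If `φ` is surjective on `H_1(-; ℚ)`, then an additive function on `B` that vanishes on the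
image of `φ` vanishes. -/
theorem eq_zero_of_H1_surjective (hφ : Function.Surjective (Hlgy.map ℚ φ 1)) (χ : B → ℚ)
    (hχ : ∀ a b, χ (a * b) = χ a + χ b) (h0 : ∀ a, χ (φ a) = 0) (b : B) : χ b = 0 := by
  obtain ⟨F, hF⟩ := exists_linear_factor (H1class B) (chainEval χ) (by
    intro c hc
    obtain ⟨e, rfl⟩ := (H1class_eq_zero_iff c).1 hc
    rw [chainEval_d21 (fun _ => 0) χ (fun a b => by rw [hχ]; ring), chainEval_zero])
  have hF0 : ∀ x, F x = 0 := by
    intro x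
    obtain ⟨y, rfl⟩ := hφ x
    obtain ⟨c, rfl⟩ := H1class_surjective y
    rw [map_H1class, hF]
    induction c using Finsupp.induction_linear with
    | zero => simp
    | add f g hf hg => rw [Finsupp.mapDomain_add, map_add, hf, hg, add_zero]
    | single x a =>
      rw [Finsupp.mapDomain_single, chainEval_single, h0]
      exact mul_zero a
  have := hF (Finsupp.single b 1)
  rw [hF0, chainEval_single, one_mul] at this
  exact (congrArg ULift.down this).symm

end H1

section H2

variable {A B : Type u} [Group A] [Group B] (φ : A →* B)

/-- The map on `H_2` is induced by the obvious map on cycles of the bar resolution. -/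
theorem coe_map_cycles₂ (R : Type) [CommRing R]
    (c : groupHomology.cycles₂ (trivialCoeff R A)) :
    ∃ c' : groupHomology.cycles₂ (trivialCoeff R B),
      c'.1 = Finsupp.mapDomain (Prod.map φ φ) c.1 ∧
      Hlgy.map R φ 2 (groupHomology.H2π (trivialCoeff R A) c) =
        groupHomology.H2π (trivialCoeff R B) c' := by
  refine ⟨groupHomology.mapCycles₂ (A := trivialCoeff R A) (B := trivialCoeff R B) φ
    (𝟙 (trivialCoeff R A)) c, ?_, ?_⟩
  · exact Finsupp.ext fun _ => rfl
  · exact groupHomology.H2π_comp_map_apply (A := trivialCoeff R A) (B := trivialCoeff R B) φ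
      (𝟙 (trivialCoeff R A)) c

/-- A rational 2-cocycle on `B` whose restrictions along `φ` and to `N` are coboundaries is itself a
coboundary, if `H_2(A; ℚ)` and the image of `H_2(N)` generate `H_2(B; ℚ)`. -/
theorem exists_coboundary_of_H2_surjective (N : Subgroup B)
    (hφ : Function.Surjective ((PhiSpan N).mkQ ∘ₗ Hlgy.map ℚ φ 2)) (α : B × B → ℚ)
    (hα : ∀ a b c, α (a, b) + α (a * b, c) = α (b, c) + α (a, b * c))
    (β₁ : A → ℚ) (hβ₁ : ∀ a b, α (φ a, φ b) = β₁ a + β₁ b - β₁ (a * b))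
    (β₂ : N → ℚ) (hβ₂ : ∀ a b : N, α (a, b) = β₂ a + β₂ b - β₂ (a * b)) :
    ∃ β : B → ℚ, ∀ a b, α (a, b) = β a + β b - β (a * b) := by
  have hmap : ∀ {C : Type u} [Group C] (f : C →* B) (γ : C → ℚ),
      (∀ a b, α (f a, f b) = γ a + γ b - γ (a * b)) → ∀ c : C × C →₀ ULift.{u} ℚ,
      groupHomology.d₂₁ (trivialCoeff ℚ C) c = 0 →
      chainEval α (Finsupp.mapDomain (Prod.map f f) c) = 0 := by
    intro C _ f γ hγ c hc
    have e : ∀ c, chainEval α (Finsupp.mapDomain (Prod.map f f) c) =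
        chainEval (fun p : C × C => α (f p.1, f p.2)) c := by
      intro c
      induction c using Finsupp.induction_linear with
      | zero => simp
      | add f g hf hg => rw [Finsupp.mapDomain_add, map_add, hf, hg, map_add]
      | single x a => rw [Finsupp.mapDomain_single, chainEval_single, chainEval_single]; rfl
    rw [e, ← chainEval_d21 _ γ hγ, hc, map_zero]
  obtain ⟨F, hF⟩ := exists_linear_factor (groupHomology.H2π (trivialCoeff ℚ B)).hom
    (chainEval α ∘ₗ (groupHomology.cycles₂ (trivialCoeff ℚ B)).subtype) (by
      intro c hc
      obtain ⟨e, he⟩ := (groupHomology.H2π_eq_zero_iff c).1 hc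
      rw [LinearMap.comp_apply, Submodule.subtype_apply]
      refine (congrArg (chainEval α) he).symm.trans ?_
      exact chainEval_d32 α hα e)
  have hFA : ∀ x, F (Hlgy.map ℚ φ 2 x) = 0 := by
    intro x
    obtain ⟨c, rfl⟩ := (ModuleCat.epi_iff_surjective (groupHomology.H2π (trivialCoeff ℚ A))).1
      inferInstance x
    obtain ⟨c', hc', e⟩ := coe_map_cycles₂ φ ℚ c
    rw [e]
    refine (hF c').trans ?_
    rw [LinearMap.comp_apply, Submodule.subtype_apply, hc']
    exact hmap φ β₁ hβ₁ c.1 c.2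
  have hFN : PhiSpan N ≤ LinearMap.ker F := by
    refine Submodule.span_le.2 ?_
    rintro _ ⟨_, ⟨y, rfl⟩, rfl⟩
    obtain ⟨c, rfl⟩ := H2pi_surjective N y
    obtain ⟨c', hc', e⟩ := coe_map_cycles₂ N.subtype ℤ c
    change F (H2IntToRat B (Hlgy.map ℤ N.subtype 2 (groupHomology.H2π (trivialCoeff ℤ N) c))) = 0
    rw [e, H2IntToRat_H2pi]
    refine (hF _).trans ?_
    change chainEval α (chainsCast (B × B) c'.1) = 0
    have e2 : chainsCast (B × B) c'.1 =
        Finsupp.mapDomain (Prod.map N.subtype N.subtype) (cyclesCast N c).1 := by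
      rw [hc']
      change _ = Finsupp.mapDomain _ (chainsCast (N × N) c.1)
      generalize c.1 = x
      induction x using Finsupp.induction_linear with
      | zero => simp
      | add f g hf hg =>
        rw [Finsupp.mapDomain_add, map_add, hf, hg, map_add, Finsupp.mapDomain_add]
      | single x a =>
        rw [Finsupp.mapDomain_single, chainsCast_single, chainsCast_single,
          Finsupp.mapDomain_single]
    rw [e2]
    exact hmap N.subtype β₂ hβ₂ _ (cyclesCast N c).2
  have hF0 : ∀ x, F x = 0 := by
    intro x
    obtain ⟨y, hy⟩ := hφ ((PhiSpan N).mkQ x)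
    rw [LinearMap.comp_apply, Submodule.mkQ_apply, Submodule.mkQ_apply,
      Submodule.Quotient.eq] at hy
    have h1 := hFN hy
    rw [LinearMap.mem_ker, map_sub, hFA, zero_sub, neg_eq_zero] at h1
    exact h1
  obtain ⟨E, hE⟩ := exists_linear_factor (groupHomology.d₂₁ (trivialCoeff ℚ B)).hom
    (chainEval α) (by
      intro c hc
      have := hF ⟨c, hc⟩
      rw [hF0] at this
      exact this.symm)
  refine ⟨fun b => (E (Finsupp.single b 1)).down, fun a b => ?_⟩
  have h1 := hE (Finsupp.single (a, b) 1)
  erw [groupHomology.d₂₁_single, chainEval_single] at h1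
  rw [one_mul, map_add, map_sub] at h1
  have h2 := congrArg ULift.down h1
  change (E (Finsupp.single b 1)).down - (E (Finsupp.single (a * b) 1)).down +
    (E (Finsupp.single a 1)).down = α (a, b) at h2
  rw [← h2]
  ring

end H2

/-! ### Extending homomorphisms from the kernel of a surjection -/

section Extend

theorem additive_one {E : Type*} [Group E] {χ : E → ℚ} (hχ : ∀ a b, χ (a * b) = χ a + χ b) :
    χ 1 = 0 := by
  have := hχ 1 1
  rw [mul_one] at this
  linarith

theorem additive_inv {E : Type*} [Group E] {χ : E → ℚ} (hχ : ∀ a b, χ (a * b) = χ a + χ b)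
    (a : E) : χ a⁻¹ = -χ a := by
  have := hχ a a⁻¹
  rw [mul_inv_cancel, additive_one hχ] at this
  linarith

/-- Let `l` be an invariant homomorphism to `ℚ` on the kernel of the surjection `p : E → B`. It
defines a central extension of `B`, whose class lies in `H²(B; ℚ)`. If this class vanishes on `N`
(since `l` extends over the preimage of `N`) and on `A` (since `l` pulls back to a function that
extends to `χ` on `E'`), then under the assumptions on homology it vanishes, so that `l` extends to
`E`; an extension compatible with `χ` is found with the assumption on `H_1`. -/
theorem exists_additive_extension {A B E E' : Type u} [Group A] [Group B] [Group E] [Group E']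
    (φ : A →* B) (N : Subgroup B)
    (hH1 : Function.Injective (Hlgy.map ℚ φ 1))
    (hH2 : Function.Surjective ((PhiSpan N).mkQ ∘ₗ Hlgy.map ℚ φ 2))
    (p : E →* B) (hp : Function.Surjective p) (q : E' →* A) (hq : Function.Surjective q)
    (ψ : E' →* E) (hψ : ∀ w, p (ψ w) = φ (q w)) (l : E → ℚ)
    (hlN : ∀ u v, p u ∈ N → l (u * v) = l u + l v)
    (hl : ∀ f u, p u = 1 → l (f * u * f⁻¹) = l u)
    (χ : E' → ℚ) (hχ : ∀ a b, χ (a * b) = χ a + χ b) (hχl : ∀ w, q w = 1 → χ w = l (ψ w)) :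
    ∃ h : E → ℚ, (∀ a b, h (a * b) = h a + h b) ∧ (∀ u, p u = 1 → h u = l u) ∧
      ∀ w, h (ψ w) = χ w := by
  choose s hs using hp
  choose t ht using hq
  have hl1 : ∀ u v, p u = 1 → l (u * v) = l u + l v := fun u v hu =>
    hlN u v (by rw [hu]; exact N.one_mem)
  have hone : l 1 = 0 := by
    have := hl1 1 1 (map_one p)
    rw [mul_one] at this
    linarith
  have hinv : ∀ u, p u ∈ N → l u⁻¹ = -l u := by
    intro u hu
    have := hlN u u⁻¹ hu
    rw [mul_inv_cancel, hone] at this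
    linarith
  -- the factor set of the section `s`; its image `α` under `l` is a cocycle
  obtain ⟨c, hcs⟩ : ∃ c : B → B → E, ∀ a b, c a b = s a * s b * (s (a * b))⁻¹ :=
    ⟨_, fun _ _ => rfl⟩
  have hc : ∀ a b, p (c a b) = 1 := fun a b => by simp [hcs, hs]
  let α : B × B → ℚ := fun x => l (c x.1 x.2)
  have hα : ∀ a b d, α (a, b) + α (a * b, d) = α (b, d) + α (a, b * d) := by
    intro a b d
    have e : c a b * c (a * b) d = s a * c b d * (s a)⁻¹ * c a (b * d) := by
      simp only [hcs, mul_assoc, inv_mul_cancel_left]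
    have := congrArg l e
    rw [hl1 _ _ (hc a b), hl1 (s a * c b d * (s a)⁻¹) _ (by simp [hc]), hl _ _ (hc b d)] at this
    exact this
  -- the comparison of the lift `ψ ∘ t` with the section `s`; with its help the restriction of `α`
  -- to `A` is the coboundary of `χ ∘ t - l ∘ k`
  obtain ⟨k, hkt⟩ : ∃ k : A → E, ∀ a, k a = ψ (t a) * (s (φ a))⁻¹ := ⟨_, fun _ => rfl⟩
  have hk : ∀ a, p (k a) = 1 := fun a => by simp [hkt, hs, hψ, ht]
  obtain ⟨β, hβ⟩ := exists_coboundary_of_H2_surjective φ N hH2 α hα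
    (fun a => χ (t a) - l (k a)) (by
      intro a b
      have e : ψ (t a * t b * (t (a * b))⁻¹) = k a * ((s (φ a)) * k b * (s (φ a))⁻¹ *
          (c (φ a) (φ b) * (k (a * b))⁻¹)) := by
        simp only [hkt, hcs, map_mul, map_inv]
        group
      have h1 := congrArg l e
      rw [← hχl _ (by simp [ht]), hl1 _ _ (hk a),
        hl1 (s (φ a) * k b * (s (φ a))⁻¹) _ (by simp [hk]), hl _ _ (hk b),
        hl1 _ _ (hc _ _), hinv _ (by rw [hk]; exact N.one_mem), hχ, hχ, additive_inv hχ] at h1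
      change l (c (φ a) (φ b)) = _
      linarith)
    (fun n => l (s n)) (by
      intro a b
      change l (c a b) = _
      rw [hcs, mul_assoc, hlN _ _ (by rw [hs]; exact a.2), hlN _ _ (by rw [hs]; exact b.2),
        hinv _ (by rw [hs]; exact (a * b).2)]
      rw [Subgroup.coe_mul]
      ring)
  -- an extension of `l`, still to be corrected to agree with `χ`
  let h₀ : E → ℚ := fun f => l (f * (s (p f))⁻¹) + β (p f)
  have hadd : ∀ f g, h₀ (f * g) = h₀ f + h₀ g := by
    intro f g
    have e : f * g * (s (p (f * g)))⁻¹ = f * (s (p f))⁻¹ *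
        (s (p f) * (g * (s (p g))⁻¹) * (s (p f))⁻¹ * c (p f) (p g)) := by
      simp only [hcs, map_mul]
      group
    have h1 := hβ (p f) (p g)
    change l (c (p f) (p g)) = _ at h1
    simp only [h₀]
    rw [e, hl1 (f * (s (p f))⁻¹) _ (by simp [hs]),
      hl1 (s (p f) * (g * (s (p g))⁻¹) * (s (p f))⁻¹) _ (by simp [hs]), hl _ _ (by simp [hs]), h1,
      map_mul]
    ring
  have hker : ∀ u, p u = 1 → h₀ u = l u := by
    intro u hu
    have h1 := hβ 1 1
    change l (c 1 1) = _ at h1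
    rw [hcs, mul_one, mul_inv_cancel_right] at h1
    simp only [h₀]
    rw [hl1 _ _ hu, hu, hinv _ (by rw [hs]; exact N.one_mem), h1]
    ring
  let χ' : E' → ℚ := fun w => h₀ (ψ w) - χ w
  have hχ' : ∀ a b, χ' (a * b) = χ' a + χ' b := fun a b => by
    simp only [χ', map_mul, hadd, hχ]; ring
  have hχ'0 : ∀ w, q w = 1 → χ' w = 0 := fun w hw => by
    simp only [χ']
    rw [hker _ (by rw [hψ, hw, map_one]), hχl w hw, sub_self]
  have hχ't : ∀ w, χ' (t (q w)) = χ' w := by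
    intro w
    have := hχ'0 (t (q w) * w⁻¹) (by simp [ht])
    rw [hχ', additive_inv hχ'] at this
    linarith
  obtain ⟨h₁, hh₁, hh₁φ⟩ := exists_extension_of_H1_injective φ hH1 (fun a => χ' (t a))
    (fun a b => by
      have := hχ't (t a * t b)
      rw [map_mul, ht, ht] at this
      rw [this, hχ'])
  refine ⟨fun f => h₀ f - h₁ (p f), fun a b => ?_, fun u hu => ?_, fun w => ?_⟩
  · simp only [map_mul, hadd, hh₁]; ring
  · change h₀ u - h₁ (p u) = l u
    rw [hker u hu, hu, additive_one hh₁, sub_zero]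
  · change h₀ (ψ w) - h₁ (p (ψ w)) = χ w
    rw [hψ, hh₁φ, hχ't]
    simp only [χ']; ring

end Extend

/-! ### Ranks over the group ring and over `ℚ` -/

section Rank

variable {Γ : Type u} [Group Γ]

/-- The augmentation of a vector over `ℤ[Γ]`, with rational coefficients. -/
noncomputable def augmVec (Γ : Type u) [Group Γ] (J : Type u) :
    (J →₀ MonoidAlgebra ℤ Γ) →+ (J →₀ ℚ) :=
  Finsupp.mapRange.addMonoidHom ((Int.castAddHom ℚ).comp (augm Γ).toAddMonoidHom)

theorem augmVec_apply {J : Type u} (v : J →₀ MonoidAlgebra ℤ Γ) (y : J) :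
    augmVec Γ J v y = (augm Γ (v y) : ℚ) := rfl

theorem augmVec_single {J : Type u} (y : J) (a : MonoidAlgebra ℤ Γ) :
    augmVec Γ J (Finsupp.single y a) = Finsupp.single y (augm Γ a : ℚ) := by
  simp [augmVec]

theorem AugmentationDetects.linearIndependent (hΓ : AugmentationDetects Γ) {I J : Type u}
    [Fintype I] (v : I → J →₀ MonoidAlgebra ℤ Γ)
    (h : LinearIndependent ℚ fun i => augmVec Γ J (v i)) :
    LinearIndependent (MonoidAlgebra ℤ Γ) v := by
  apply hΓ
  rw [Fintype.linearIndependent_iff] at h ⊢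
  intro g hg i
  have h1 := h (fun i => (g i : ℚ)) (by
    ext y
    have := congrArg (fun z : J →₀ ℤ => ((z y : ℤ) : ℚ)) hg
    simpa [Finsupp.finsetSum_apply, augmVec_apply] using this) i
  exact_mod_cast h1

/-- If the augmentations of `u i` span, then every vector has a non-zero multiple in the span of
the `u i`. -/
theorem exists_smul_mem_span_of_augmVec_span [StrongRankCondition (MonoidAlgebra ℤ Γ)]
    (hΓ : AugmentationDetects Γ) {ι J : Type u} [Fintype ι] (u : ι → J →₀ MonoidAlgebra ℤ Γ)
    (hu : Submodule.span ℚ (Set.range fun i => augmVec Γ J (u i)) = ⊤)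
    (v : J →₀ MonoidAlgebra ℤ Γ) :
    ∃ a : MonoidAlgebra ℤ Γ, a ≠ 0 ∧ a • v ∈ Submodule.span (MonoidAlgebra ℤ Γ) (Set.range u) := by
  classical
  obtain ⟨κ, f, hf, hspan, hind⟩ := exists_linearIndependent' ℚ fun i => augmVec Γ J (u i)
  have : Finite κ := Finite.of_injective f hf
  let _ := Fintype.ofFinite κ
  let b := Module.Basis.mk hind (by rw [hspan, hu])
  have : Module.Finite ℚ (J →₀ ℚ) := Module.Finite.of_basis b
  have : Finite J := (Module.Finite.finite_basis (Finsupp.basisSingleOne (R := ℚ) (ι := J)))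
  let _ := Fintype.ofFinite J
  have hcard : Fintype.card κ = Fintype.card J := by
    rw [← Module.finrank_eq_card_basis b,
      Module.finrank_eq_card_basis (Finsupp.basisSingleOne (R := ℚ) (ι := J))]
  by_contra! hcon
  have hind' := hΓ.linearIndependent (fun k => u (f k)) hind
  let w : Option κ → J →₀ MonoidAlgebra ℤ Γ := fun o => o.elim v fun k => u (f k)
  have hw : LinearIndependent (MonoidAlgebra ℤ Γ) w := by
    rw [Fintype.linearIndependent_iff] at hind' ⊢
    intro g hg
    rw [Fintype.sum_option] at hg
    have h0 : g none = 0 := by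
      by_contra hne
      refine hcon _ hne ?_
      have : g none • v = -∑ k, g (some k) • u (f k) := eq_neg_of_add_eq_zero_left hg
      rw [this]
      exact neg_mem (sum_mem fun k _ => Submodule.smul_mem _ _
        (Submodule.subset_span ⟨f k, rfl⟩))
    rw [h0, zero_smul, zero_add] at hg
    have h1 := hind' (fun k => g (some k)) hg
    rintro (_ | k)
    · exact h0
    · exact h1 k
  have := card_le_of_injective' (MonoidAlgebra ℤ Γ)
    (Finsupp.linearCombination (MonoidAlgebra ℤ Γ) w) hw
  rw [Fintype.card_option] at this
  omega

/-- Exactness at a finitely generated free module over `ℤ[Γ]` follows from exactness over `ℚ`, up to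
torsion. The exactness over `ℚ` is expressed dually: a linear functional that vanishes on the
augmentations of the elements of `S` factors through the augmentation of `d`. Since ranks of
matrices can only grow when passing from `ℚ` to `ℤ[Γ]`, the span of `S` has the rank of the kernel
of `d`. -/
theorem exists_smul_mem_span_of_ker [StrongRankCondition (MonoidAlgebra ℤ Γ)]
    (hΓ : AugmentationDetects Γ) {ι J : Type u} [Fintype ι]
    (d : (ι →₀ MonoidAlgebra ℤ Γ) →ₗ[MonoidAlgebra ℤ Γ] (J →₀ MonoidAlgebra ℤ Γ))
    (S : Set (ι →₀ MonoidAlgebra ℤ Γ)) (hS : ∀ x ∈ S, d x = 0)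
    (H : ∀ ψ : ι → ℚ, (∀ x ∈ S, Finsupp.linearCombination ℚ ψ (augmVec Γ ι x) = 0) →
      ∃ h : (J →₀ ℚ) →ₗ[ℚ] ℚ, ∀ i, ψ i = h (augmVec Γ J (d (Finsupp.single i 1))))
    (z : ι →₀ MonoidAlgebra ℤ Γ) (hz : d z = 0) :
    ∃ a : MonoidAlgebra ℤ Γ, a ≠ 0 ∧ a • z ∈ Submodule.span (MonoidAlgebra ℤ Γ) S := by
  classical
  obtain ⟨κ₁, f₁, hf₁, hspan₁, hind₁⟩ :=
    exists_linearIndependent' ℚ fun x : S => augmVec Γ ι (x : ι →₀ MonoidAlgebra ℤ Γ)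
  obtain ⟨κ₂, f₂, hf₂, hspan₂, hind₂⟩ :=
    exists_linearIndependent' ℚ fun i : ι => augmVec Γ J (d (Finsupp.single i 1))
  have : Finite κ₁ := hind₁.finite
  have : Finite κ₂ := Finite.of_injective f₂ hf₂
  let _ := Fintype.ofFinite κ₁
  let _ := Fintype.ofFinite κ₂
  -- a functional that vanishes on the chosen elements of `S` is determined by its values on the
  -- chosen basis vectors
  have hcard : Fintype.card ι ≤ Fintype.card κ₁ + Fintype.card κ₂ := by
    let Θ : (ι → ℚ) →ₗ[ℚ] (κ₁ → ℚ) × (κ₂ → ℚ) :=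
      { toFun := fun ψ => (fun k => Finsupp.linearCombination ℚ ψ (augmVec Γ ι (f₁ k : ι →₀ _)),
          fun k => ψ (f₂ k))
        map_add' := fun ψ ψ' => by
          ext k
          · simp [Finsupp.linearCombination_apply, Finsupp.sum, mul_add, Finset.sum_add_distrib]
          · simp
        map_smul' := fun r ψ => by
          ext k
          · simp [Finsupp.linearCombination_apply, Finsupp.sum, Finset.mul_sum, mul_left_comm]
          · simp }
    have hΘ : Function.Injective Θ := by
      rw [← LinearMap.ker_eq_bot, LinearMap.ker_eq_bot']
      intro ψ hψ
      have h1 : Submodule.span ℚ (Set.range fun x : S => augmVec Γ ι (x : ι →₀ _)) ≤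
          LinearMap.ker (Finsupp.linearCombination ℚ ψ) := by
        rw [← hspan₁]
        refine Submodule.span_le.2 ?_
        rintro _ ⟨k, rfl⟩
        exact congrFun (congrArg Prod.fst hψ) k
      obtain ⟨h, hh⟩ := H ψ fun x hx => h1 (Submodule.subset_span ⟨⟨x, hx⟩, rfl⟩)
      have h2 : Submodule.span ℚ (Set.range fun i : ι => augmVec Γ J (d (Finsupp.single i 1))) ≤
          LinearMap.ker h := by
        rw [← hspan₂]
        refine Submodule.span_le.2 ?_
        rintro _ ⟨k, rfl⟩
        have := congrFun (congrArg Prod.snd hψ) k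
        exact (hh (f₂ k)).symm.trans this
      funext i
      rw [hh i]
      exact h2 (Submodule.subset_span ⟨i, rfl⟩)
    have := LinearMap.finrank_le_finrank_of_injective hΘ
    simpa [Module.finrank_prod] using this
  by_contra! hcon
  have hi₁ := hΓ.linearIndependent (fun k => (f₁ k : ι →₀ MonoidAlgebra ℤ Γ)) hind₁
  have hi₂ := hΓ.linearIndependent (fun k => d (Finsupp.single (f₂ k) 1)) hind₂
  let w : Option (κ₁ ⊕ κ₂) → ι →₀ MonoidAlgebra ℤ Γ := fun o =>
    o.elim z (Sum.elim (fun k => (f₁ k : ι →₀ _)) fun k => Finsupp.single (f₂ k) 1)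
  -- otherwise there would be more than `card ι` independent vectors
  have hw : LinearIndependent (MonoidAlgebra ℤ Γ) w := by
    rw [Fintype.linearIndependent_iff] at hi₁ hi₂ ⊢
    intro g hg
    rw [Fintype.sum_option, Fintype.sum_sum_type] at hg
    simp only [w, Option.elim_none, Option.elim_some, Sum.elim_inl, Sum.elim_inr] at hg
    have h2 := hi₂ (fun k => g (some (Sum.inr k))) (by
      have := congrArg d hg
      simp only [map_add, map_sum, map_smul, hz, smul_zero, zero_add, map_zero,
        hS _ (f₁ _).2, Finset.sum_const_zero] at this
      exact this)
    have h2' : ∀ k, g (some (Sum.inr k)) = 0 := h2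
    simp only [h2', zero_smul, Finset.sum_const_zero, add_zero] at hg
    have h0 : g none = 0 := by
      by_contra hne
      refine hcon _ hne ?_
      have : g none • z = -∑ k, g (some (Sum.inl k)) • (f₁ k : ι →₀ MonoidAlgebra ℤ Γ) :=
        eq_neg_of_add_eq_zero_left hg
      rw [this]
      exact neg_mem (sum_mem fun k _ => Submodule.smul_mem _ _ (Submodule.subset_span (f₁ k).2))
    rw [h0, zero_smul, zero_add] at hg
    have h1 := hi₁ (fun k => g (some (Sum.inl k))) hg
    rintro (_ | k | k)
    · exact h0
    · exact h1 k
    · exact h2' k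
  have := card_le_of_injective' (MonoidAlgebra ℤ Γ)
    (Finsupp.linearCombination (MonoidAlgebra ℤ Γ) w) hw
  rw [Fintype.card_option, Fintype.card_sum] at this
  omega

end Rank

/-! ### Crossed homomorphisms on presented groups -/

namespace IsCrossedHom

section General

variable {G S M : Type*} [Group G] [Ring S] [AddCommGroup M] [Module S M] {ρ : G →* S} {D : G → M}

/-- If `s` acts trivially, a submodule that contains the image of `s` contains the image of its
normal closure. -/
theorem mem_of_mem_normalClosure (hD : IsCrossedHom ρ D) {s : Set G} (hs : ∀ g ∈ s, ρ g = 1)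
    (P : Submodule S M) (h : ∀ g ∈ s, D g ∈ P) {g : G} (hg : g ∈ Subgroup.normalClosure s) :
    D g ∈ P := by
  let L : Subgroup G :=
    { carrier := {g | ρ g = 1 ∧ D g ∈ P}
      one_mem' := ⟨_root_.map_one ρ, by rw [hD.map_one]; exact P.zero_mem⟩
      mul_mem' := fun {a b} ha hb => ⟨by rw [map_mul, ha.1, hb.1, mul_one], by
        rw [hD.map_mul_of_eq_one ha.1]; exact P.add_mem ha.2 hb.2⟩
      inv_mem' := fun {a} ha => ⟨by
          have := map_mul ρ a⁻¹ a
          rw [inv_mul_cancel, _root_.map_one, ha.1, mul_one] at this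
          exact this.symm, by
        rw [hD.map_inv]; exact P.neg_mem (P.smul_mem _ ha.2)⟩ }
  have hL : L.Normal := ⟨fun a ha g => ⟨by
      rw [map_mul, map_mul, ha.1, mul_one, ← map_mul, mul_inv_cancel, _root_.map_one], by
    rw [hD.map_conj g ha.1]; exact P.smul_mem _ ha.2⟩⟩
  have hle : Subgroup.normalClosure s ≤ L :=
    Subgroup.normalClosure_le_normal fun g hg => ⟨hs g hg, h g hg⟩
  exact (hle hg).2

theorem map_semilinear (hD : IsCrossedHom ρ D) {S' M' : Type*} [Ring S'] [AddCommGroup M']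
    [Module S' M'] {j : S →+* S'} (F : M →ₛₗ[j] M') :
    IsCrossedHom ((j : S →* S').comp ρ) (F ∘ D) := fun g h => by
  simp only [Function.comp_apply, hD g h, map_add, map_smulₛₗ]
  rfl

theorem neg (hD : IsCrossedHom ρ D) : IsCrossedHom ρ fun g => -D g := fun g h => by
  simp only [hD g h, smul_neg, neg_add]

theorem eq_of_freeGroup {X : Type*} {ρ : FreeGroup X →* S} {D E : FreeGroup X → M}
    (hD : IsCrossedHom ρ D) (hE : IsCrossedHom ρ E)
    (h : ∀ x, D (FreeGroup.of x) = E (FreeGroup.of x)) (w : FreeGroup X) : D w = E w :=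
  hD.eqOn_closure hE (s := Set.range FreeGroup.of) (by rintro _ ⟨x, rfl⟩; exact h x) w
    (by rw [FreeGroup.closure_range_of]; trivial)

/-- A crossed homomorphism that vanishes on the kernel of a surjection `p` descends along `p`. -/
theorem exists_descent {B : Type*} [Group B] {ρ : B →* S} {p : G →* B}
    (hp : Function.Surjective p) (hD : IsCrossedHom (ρ.comp p) D) (h : ∀ g, p g = 1 → D g = 0) :
    ∃ D' : B → M, IsCrossedHom ρ D' ∧ ∀ g, D' (p g) = D g := by
  have key : ∀ g g', p g = p g' → D g = D g' := by
    intro g g' hgg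
    have := hD g (g⁻¹ * g')
    rw [mul_inv_cancel_left, h (g⁻¹ * g') (by simp [hgg]), smul_zero, add_zero] at this
    exact this.symm
  choose s hs using hp
  refine ⟨fun b => D (s b), fun a b => ?_, fun g => key _ _ (hs _)⟩
  change D (s (a * b)) = D (s a) + ρ a • D (s b)
  rw [key (s (a * b)) (s a * s b) (by simp [hs]), hD, MonoidHom.comp_apply, hs]

end General

end IsCrossedHom

section Augmentation

variable {Γ : Type u} [Group Γ]

theorem augmVec_smul {J : Type u} (a : MonoidAlgebra ℤ Γ) (v : J →₀ MonoidAlgebra ℤ Γ) :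
    augmVec Γ J (a • v) = (augm Γ a : ℚ) • augmVec Γ J v := by
  ext y
  simp [augmVec_apply]

theorem augmVec_mapDomain {J J' : Type u} (f : J → J') (v : J →₀ MonoidAlgebra ℤ Γ) :
    augmVec Γ J' (Finsupp.mapDomain f v) = Finsupp.mapDomain f (augmVec Γ J v) := by
  induction v using Finsupp.induction_linear with
  | zero => simp
  | add a b ha hb => rw [Finsupp.mapDomain_add, map_add, ha, hb, map_add, Finsupp.mapDomain_add]
  | single y a => rw [Finsupp.mapDomain_single, augmVec_single, augmVec_single,
      Finsupp.mapDomain_single]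

theorem augmVec_of_smul {J : Type u} (g : Γ) (v : J →₀ MonoidAlgebra ℤ Γ) :
    augmVec Γ J (MonoidAlgebra.of ℤ Γ g • v) = augmVec Γ J v := by
  rw [augmVec_smul, MonoidAlgebra.of_apply, augm_single, Int.cast_one, one_smul]

theorem IsCrossedHom.augmVec_mul {G J : Type u} [Group G] {ρ : G →* Γ}
    {D : G → J →₀ MonoidAlgebra ℤ Γ} (hD : IsCrossedHom ((MonoidAlgebra.of ℤ Γ).comp ρ) D)
    (a b : G) : augmVec Γ J (D (a * b)) = augmVec Γ J (D a) + augmVec Γ J (D b) := by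
  rw [hD, map_add, MonoidHom.comp_apply, augmVec_of_smul]

end Augmentation

theorem additive_eq_of_freeGroup {X : Type*} {h h' : FreeGroup X → ℚ}
    (hh : ∀ a b, h (a * b) = h a + h b) (hh' : ∀ a b, h' (a * b) = h' a + h' b)
    (e : ∀ x, h (FreeGroup.of x) = h' (FreeGroup.of x)) (w : FreeGroup X) : h w = h' w := by
  induction w using FreeGroup.induction_on with
  | C1 => rw [additive_one hh, additive_one hh']
  | of x => exact e x
  | inv_of x hx => rw [additive_inv hh, additive_inv hh', hx]
  | mul a b ha hb => rw [hh, hh', ha, hb]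

/-- The group `ℚ` is injective. -/
theorem exists_additive_factor {V W : Type*} [AddCommGroup V] [AddCommGroup W] (d : V →+ W)
    (g : V →+ ℚ) (h : ∀ v, d v = 0 → g v = 0) : ∃ F : W →+ ℚ, ∀ v, F (d v) = g v := by
  have hZ : LeftOre ℤ := fun a b ha => ⟨a, b, ha, mul_comm a b⟩
  obtain ⟨F, hF⟩ := exists_factor_of_ker_le (Int.castRingHom ℚ) Int.cast_injective hZ
    d.toIntLinearMap { g with map_smul' := fun r v => by simp } h
  exact ⟨F.toAddMonoidHom, hF⟩

theorem semilinear_eq_of_single {ι R K M : Type*} [Ring R] [Ring K] [AddCommGroup M] [Module K M]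
    {j : R →+* K} (F F' : (ι →₀ R) →ₛₗ[j] M)
    (h : ∀ i, F (Finsupp.single i 1) = F' (Finsupp.single i 1)) (v : ι →₀ R) : F v = F' v := by
  induction v using Finsupp.induction_linear with
  | zero => simp
  | add a b ha hb => rw [map_add, map_add, ha, hb]
  | single i a =>
    have : Finsupp.single i a = a • Finsupp.single i (1 : R) := by simp
    rw [this, map_smulₛₗ, map_smulₛₗ, h]

section Presentation

variable {A B Γ X Y : Type u} [Group A] [Group B] [Group Γ]

/-- The matrix of Fox derivatives of the relators of `B` and, with a sign, of the images under `ψ`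
of the generators of `A`. With coefficients in `ℤ[Γ]`, this is the boundary map from 2-chains to the
1-chains of `B` in the mapping cone of the map of presentation complexes given by `φ`. -/
noncomputable def foxMap (rels : Set (FreeGroup Y)) (ψ : FreeGroup X →* FreeGroup Y)
    (DY : FreeGroup Y → Y →₀ MonoidAlgebra ℤ Γ) :
    (rels ⊕ X →₀ MonoidAlgebra ℤ Γ) →ₗ[MonoidAlgebra ℤ Γ] (Y →₀ MonoidAlgebra ℤ Γ) :=
  Finsupp.linearCombination (MonoidAlgebra ℤ Γ)
    (Sum.elim (fun r : rels => DY r) fun x => -DY (ψ (FreeGroup.of x)))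

/-- The elements of the kernel of `foxMap` whose component in the 1-chains of `A` is the vector of
Fox derivatives of a relation `w` of `A`. -/
def foxCycles (rels : Set (FreeGroup Y)) (q : FreeGroup X →* A) (ψ : FreeGroup X →* FreeGroup Y)
    (DX : FreeGroup X → X →₀ MonoidAlgebra ℤ Γ) (DY : FreeGroup Y → Y →₀ MonoidAlgebra ℤ Γ) :
    Set (rels ⊕ X →₀ MonoidAlgebra ℤ Γ) :=
  {s | foxMap rels ψ DY s = 0 ∧ ∃ z w, q w = 1 ∧
    s = Finsupp.mapDomain Sum.inl z + Finsupp.mapDomain Sum.inr (DX w)}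

/-- Up to torsion the kernel of `foxMap` is generated by `foxCycles`; in other words, the kernel of
`H_1(A; ℤ[Γ]) → H_1(B; ℤ[Γ])` is torsion. By a count of ranks it suffices that a functional `θ` that
vanishes on the augmentations of `foxCycles` factors through the augmentation of `foxMap`. Such a
functional defines a homomorphism `l` on the relations of `B` and a homomorphism `χ` on the free
group over the generators of `A`, and a common extension of the two is the required factor. -/
theorem exists_smul_mem_span_foxCycles [StrongRankCondition (MonoidAlgebra ℤ Γ)]
    (hΓ : AugmentationDetects Γ) (φ : A →* B) (N : Subgroup B)
    (hH1 : Function.Injective (Hlgy.map ℚ φ 1))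
    (hH2 : Function.Surjective ((PhiSpan N).mkQ ∘ₗ Hlgy.map ℚ φ 2))
    (π : B →* Γ) (hπ : ∀ x ∈ N, π x = 1) [Finite X] {rels : Set (FreeGroup Y)}
    (hrels : rels.Finite) (p : FreeGroup Y →* B) (hp : Function.Surjective p)
    (hker : p.ker = Subgroup.normalClosure rels) (q : FreeGroup X →* A)
    (hq : Function.Surjective q) (ψ : FreeGroup X →* FreeGroup Y) (hψ : ∀ w, p (ψ w) = φ (q w))
    {DX : FreeGroup X → X →₀ MonoidAlgebra ℤ Γ} {DY : FreeGroup Y → Y →₀ MonoidAlgebra ℤ Γ}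
    (hDX : IsCrossedHom ((MonoidAlgebra.of ℤ Γ).comp ((π.comp p).comp ψ)) DX)
    (hDX1 : ∀ x, DX (FreeGroup.of x) = Finsupp.single x 1)
    (hDY : IsCrossedHom ((MonoidAlgebra.of ℤ Γ).comp (π.comp p)) DY)
    (hDY1 : ∀ y, DY (FreeGroup.of y) = Finsupp.single y 1)
    (z : rels ⊕ X →₀ MonoidAlgebra ℤ Γ) (hz : foxMap rels ψ DY z = 0) :
    ∃ a : MonoidAlgebra ℤ Γ, a ≠ 0 ∧
      a • z ∈ Submodule.span (MonoidAlgebra ℤ Γ) (foxCycles rels q ψ DX DY) := by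
  have := hrels.to_subtype
  let _ := Fintype.ofFinite (rels ⊕ X)
  have hrp : ∀ r ∈ rels, p r = 1 := fun r hr => by
    rw [← MonoidHom.mem_ker, hker]; exact Subgroup.subset_normalClosure hr
  let dR : (rels →₀ MonoidAlgebra ℤ Γ) →ₗ[MonoidAlgebra ℤ Γ] (Y →₀ MonoidAlgebra ℤ Γ) :=
    Finsupp.linearCombination (MonoidAlgebra ℤ Γ) fun r : rels => DY r
  have hinl : ∀ v, foxMap rels ψ DY (Finsupp.mapDomain Sum.inl v) = dR v := fun v => by
    rw [foxMap, Finsupp.linearCombination_mapDomain]; rfl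
  -- the chain rule for Fox derivatives
  have hinr : ∀ w, foxMap rels ψ DY (Finsupp.mapDomain Sum.inr (DX w)) = -DY (ψ w) := fun w => by
    rw [foxMap, Finsupp.linearCombination_mapDomain]
    refine (hDX.map_semilinear (Finsupp.linearCombination (MonoidAlgebra ℤ Γ) (Sum.elim
      (fun r : rels => DY r) (fun x => -DY (ψ (FreeGroup.of x))) ∘ Sum.inr))).eq_of_freeGroup
      (hDY.comp ψ).neg (fun x => ?_) w
    simp [hDX1]
  have hDYker : ∀ u, p u = 1 → ∃ v, dR v = DY u := by
    intro u hu
    have h1 : u ∈ Subgroup.normalClosure rels := by rw [← hker]; exact hu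
    exact hDY.mem_of_mem_normalClosure
      (fun r hr => by simp [hrp r hr, ← MonoidAlgebra.one_def]) (LinearMap.range dR)
      (fun r hr => ⟨Finsupp.single ⟨r, hr⟩ 1, by simp [dR]⟩) h1
  refine exists_smul_mem_span_of_ker hΓ (foxMap rels ψ DY) (foxCycles rels q ψ DX DY)
    (fun s hs => hs.1) (fun θ hθ => ?_) z hz
  let g : (rels →₀ MonoidAlgebra ℤ Γ) →+ ℚ :=
    (Finsupp.linearCombination ℚ fun r : rels => θ (Sum.inl r)).toAddMonoidHom.comp (augmVec Γ rels)
  let e : (X →₀ MonoidAlgebra ℤ Γ) →+ ℚ :=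
    (Finsupp.linearCombination ℚ fun x : X => θ (Sum.inr x)).toAddMonoidHom.comp (augmVec Γ X)
  have hge : ∀ v w, foxMap rels ψ DY (Finsupp.mapDomain Sum.inl v +
      Finsupp.mapDomain Sum.inr (DX w)) = 0 → q w = 1 → g v + e (DX w) = 0 := by
    intro v w h1 h2
    have := hθ _ ⟨h1, v, w, h2, rfl⟩
    rw [map_add, map_add, augmVec_mapDomain, augmVec_mapDomain,
      Finsupp.linearCombination_mapDomain, Finsupp.linearCombination_mapDomain] at this
    exact this
  obtain ⟨Ψ, hΨ⟩ := exists_additive_factor dR.toAddMonoidHom g fun v hv => by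
    have := hge v 1 (by
      rw [hDX.map_one, Finsupp.mapDomain_zero, add_zero, hinl]; exact hv) (map_one q)
    rwa [hDX.map_one, map_zero, add_zero] at this
  have hΨ' : ∀ v, Ψ (dR v) = g v := hΨ
  -- `l` is a homomorphism on the preimage of `N`, since `N` acts trivially on `ℤ[Γ]`
  obtain ⟨h, hadd, hl, hχ⟩ := exists_additive_extension φ N hH1 hH2 p hp q hq ψ hψ
    (fun u => Ψ (DY u))
    (fun u v hu => by
      rw [hDY.map_mul_of_eq_one (by simp [hπ _ hu, ← MonoidAlgebra.one_def]), map_add])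
    (fun f u hu => by
      obtain ⟨v, hv⟩ := hDYker u hu
      rw [hDY.map_conj f (by simp [hu, ← MonoidAlgebra.one_def]), ← hv, ← map_smul, hΨ', hΨ']
      simp only [g, AddMonoidHom.comp_apply, MonoidHom.comp_apply]
      rw [augmVec_of_smul])
    (fun w => -e (DX w))
    (fun a b => by
      simp only [e, AddMonoidHom.comp_apply]
      rw [IsCrossedHom.augmVec_mul hDX, map_add, neg_add])
    (fun w hw => by
      obtain ⟨v, hv⟩ := hDYker (ψ w) (by rw [hψ, hw, map_one])
      have := hge v w (by rw [map_add, hinl, hinr, hv, add_neg_cancel]) hw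
      rw [← hv, hΨ']
      linarith)
  let hlin : (Y →₀ ℚ) →ₗ[ℚ] ℚ := Finsupp.linearCombination ℚ fun y => h (FreeGroup.of y)
  have hh : ∀ w, hlin (augmVec Γ Y (DY w)) = h w := by
    refine additive_eq_of_freeGroup (fun a b => ?_) hadd fun y => ?_
    · rw [IsCrossedHom.augmVec_mul hDY, map_add]
    · rw [hDY1, augmVec_single]
      simp [hlin]
  refine ⟨hlin, ?_⟩
  rintro (r | x)
  · have h1 : foxMap rels ψ DY (Finsupp.single (Sum.inl r) 1) = DY r := by simp [foxMap]
    have h2 : dR (Finsupp.single r 1) = DY r := by simp [dR]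
    rw [h1, hh, hl _ (hrp r r.2), ← h2, hΨ']
    simp [g, augmVec_single]
  · have h1 : foxMap rels ψ DY (Finsupp.single (Sum.inr x) 1) = -DY (ψ (FreeGroup.of x)) := by
      simp [foxMap]
    rw [h1, map_neg, map_neg, hh, hχ, hDX1]
    simp [e, augmVec_single]

/-- Presentations of `A` and `B` together with a lift of `φ` to the free groups. -/
theorem exists_presentations [Group.FG A] (hB : FinitelyRelated B) (φ : A →* B) :
    ∃ (X Y : Type u) (rels : Set (FreeGroup Y)) (p : FreeGroup Y →* B) (q : FreeGroup X →* A)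
      (ψ : FreeGroup X →* FreeGroup Y), Finite X ∧ rels.Finite ∧ Function.Surjective p ∧
      p.ker = Subgroup.normalClosure rels ∧ Function.Surjective q ∧ ∀ w, p (ψ w) = φ (q w) := by
  obtain ⟨X, hX, q, hq⟩ := Group.fg_iff_exists_freeGroup_hom_surjective.1 ‹Group.FG A›
  obtain ⟨Y, rels, hrels, ⟨iso⟩⟩ := hB
  let p : FreeGroup Y →* B := iso.symm.toMonoidHom.comp (PresentedGroup.mk rels)
  have hp : Function.Surjective p :=
    iso.symm.surjective.comp (PresentedGroup.mk_surjective rels)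
  have hker : p.ker = Subgroup.normalClosure rels := by
    ext u
    rw [MonoidHom.mem_ker, ← PresentedGroup.mk_eq_one_iff]
    exact map_eq_one_iff iso.symm iso.symm.injective
  obtain ⟨s, hs⟩ := hp.hasRightInverse
  let ψ : FreeGroup X →* FreeGroup Y := FreeGroup.lift fun x => s (φ (q (FreeGroup.of x)))
  have hψ : ∀ w, p (ψ w) = φ (q w) := by
    intro w
    have : p.comp ψ = φ.comp q := by
      ext x
      simp [ψ, hs _]
    exact DFunLike.congr_fun this w
  exact ⟨X, Y, rels, p, q, ψ, hX, hrels, hp, hker, hq, hψ⟩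

/-- Under the homological assumptions on `φ`, crossed homomorphisms into a skew field extend
along `φ`. -/
theorem IsCrossedHom.exists_extension [Group.FG A] (hB : FinitelyRelated B)
    [IsDomain (MonoidAlgebra ℤ Γ)] [StrongRankCondition (MonoidAlgebra ℤ Γ)]
    (hΓ : AugmentationDetects Γ) (φ : A →* B) (N : Subgroup B)
    (hH1 : Function.Injective (Hlgy.map ℚ φ 1))
    (hH2 : Function.Surjective ((PhiSpan N).mkQ ∘ₗ Hlgy.map ℚ φ 2))
    (π : B →* Γ) (hπ : ∀ x ∈ N, π x = 1) {K : Type*} [DivisionRing K]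
    {j : MonoidAlgebra ℤ Γ →+* K} (hj : Function.Injective j) {D₀ : A → K}
    (hD₀ : IsCrossedHom ((ringAction π j).comp φ) D₀) :
    ∃ D : B → K, IsCrossedHom (ringAction π j) D ∧ ∀ a, D (φ a) = D₀ a := by
  have hR := leftOre_of_strongRankCondition (MonoidAlgebra ℤ Γ)
  obtain ⟨X, Y, rels, p, q, ψ, hX, hrels, hp, hker, hq, hψ⟩ := exists_presentations hB φ
  obtain ⟨DY, hDY, hDY1⟩ := exists_isCrossedHom_freeGroup
    ((MonoidAlgebra.of ℤ Γ).comp (π.comp p)) fun y => Finsupp.single y (1 : MonoidAlgebra ℤ Γ)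
  obtain ⟨DX, hDX, hDX1⟩ := exists_isCrossedHom_freeGroup
    ((MonoidAlgebra.of ℤ Γ).comp ((π.comp p).comp ψ))
    fun x => Finsupp.single x (1 : MonoidAlgebra ℤ Γ)
  obtain ⟨f, hf⟩ := exists_semilinear_apply_eq j hj hR
    (fun i : rels ⊕ X => Finsupp.single i (1 : MonoidAlgebra ℤ Γ))
    (Finsupp.linearIndependent_single_one _ _)
    (Sum.elim (fun _ => 0) fun x => -D₀ (q (FreeGroup.of x)))
  have hact : ((ringAction π j).comp φ).comp q =
      (j : MonoidAlgebra ℤ Γ →* K).comp ((MonoidAlgebra.of ℤ Γ).comp ((π.comp p).comp ψ)) := by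
    ext x
    simp [hψ]
  have hD₀q := hD₀.comp q
  rw [hact] at hD₀q
  have hfinl : ∀ v, f (Finsupp.mapDomain Sum.inl v) = 0 :=
    semilinear_eq_of_single (f.comp (Finsupp.lmapDomain (MonoidAlgebra ℤ Γ) (MonoidAlgebra ℤ Γ)
      (Sum.inl : rels → rels ⊕ X))) 0 fun r => by simp [hf]
  have hfinr : ∀ w, f (Finsupp.mapDomain Sum.inr (DX w)) = -D₀ (q w) :=
    (hDX.map_semilinear (f.comp (Finsupp.lmapDomain (MonoidAlgebra ℤ Γ) (MonoidAlgebra ℤ Γ)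
      (Sum.inr : X → rels ⊕ X)))).eq_of_freeGroup hD₀q.neg fun x => by simp [hf, hDX1]
  have hspan : Submodule.span (MonoidAlgebra ℤ Γ) (foxCycles rels q ψ DX DY) ≤
      LinearMap.ker f := by
    refine Submodule.span_le.2 ?_
    rintro _ ⟨-, v, w, hw, rfl⟩
    change f _ = 0
    rw [map_add, hfinl, hfinr, hw, hD₀.map_one, neg_zero, add_zero]
  obtain ⟨F, hF⟩ := exists_factor_of_ker_le j hj hR (foxMap rels ψ DY) f fun z hz => by
    obtain ⟨a, ha, haz⟩ := exists_smul_mem_span_foxCycles hΓ φ N hH1 hH2 π hπ hrels p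
      hp hker q hq ψ hψ hDX hDX1 hDY hDY1 z hz
    have h1 : f (a • z) = 0 := hspan haz
    rw [map_smulₛₗ, smul_eq_mul] at h1
    exact (mul_eq_zero.1 h1).resolve_left fun h => ha (hj (by rw [h, map_zero]))
  have hFD := hDY.map_semilinear F
  obtain ⟨D, hD, hDp⟩ := IsCrossedHom.exists_descent (ρ := ringAction π j) (p := p)
    hp hFD fun u hu => by
      have h1 : u ∈ Subgroup.normalClosure rels := by rw [← hker]; exact hu
      have hrp : ∀ r ∈ rels, p r = 1 := fun r hr => by
        rw [← MonoidHom.mem_ker, hker]; exact Subgroup.subset_normalClosure hr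
      exact hFD.mem_of_mem_normalClosure
        (fun r hr => by simp [hrp r hr, ← MonoidAlgebra.one_def]) ⊥ (fun r hr => by
        have h2 := hF (Finsupp.single (Sum.inl ⟨r, hr⟩) 1)
        rw [hf] at h2
        simpa [foxMap] using h2) h1
  refine ⟨D, hD, fun a => ?_⟩
  obtain ⟨w, rfl⟩ := hq a
  rw [← hψ, hDp]
  refine (hFD.comp ψ).eq_of_freeGroup hD₀q (fun x => ?_) w
  have h2 := hF (Finsupp.single (Sum.inr x) 1)
  rw [hf] at h2
  simpa [foxMap] using h2

/-- If `φ` is surjective on `H_1(-; ℚ)`, then a crossed homomorphism on `B` into a skew field is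
determined by its restriction to `A`. -/
theorem IsCrossedHom.eq_zero_of_comp_eq_zero [Group.FG A] (hB : FinitelyRelated B)
    [IsDomain (MonoidAlgebra ℤ Γ)] [StrongRankCondition (MonoidAlgebra ℤ Γ)]
    (hΓ : AugmentationDetects Γ) (φ : A →* B)
    (hH1 : Function.Surjective (Hlgy.map ℚ φ 1)) (π : B →* Γ) {K : Type*} [DivisionRing K]
    {j : MonoidAlgebra ℤ Γ →+* K} (hj : Function.Injective j) {D : B → K}
    (hD : IsCrossedHom (ringAction π j) D) (h0 : ∀ a, D (φ a) = 0) (b : B) : D b = 0 := by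
  obtain ⟨X, Y, rels, p, q, ψ, hX, hrels, hp, hker, hq, hψ⟩ := exists_presentations hB φ
  have := hrels.to_subtype
  let _ := Fintype.ofFinite (rels ⊕ X)
  have hrp : ∀ r ∈ rels, p r = 1 := fun r hr => by
    rw [← MonoidHom.mem_ker, hker]; exact Subgroup.subset_normalClosure hr
  obtain ⟨DY, hDY, hDY1⟩ := exists_isCrossedHom_freeGroup
    ((MonoidAlgebra.of ℤ Γ).comp (π.comp p)) fun y => Finsupp.single y (1 : MonoidAlgebra ℤ Γ)
  let u : rels ⊕ X → Y →₀ MonoidAlgebra ℤ Γ :=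
    Sum.elim (fun r => DY r) fun x => DY (ψ (FreeGroup.of x))
  have hu : Submodule.span ℚ (Set.range fun i => augmVec Γ Y (u i)) = ⊤ := by
    by_contra hne
    obtain ⟨h, hh0, hle⟩ := Submodule.exists_le_ker_of_lt_top _ (lt_top_iff_ne_top.2 hne)
    apply hh0
    have hhu : ∀ i, h (augmVec Γ Y (u i)) = 0 := fun i => hle (Submodule.subset_span ⟨i, rfl⟩)
    have hadd : IsCrossedHom (1 : FreeGroup Y →* ℚ) fun w => h (augmVec Γ Y (DY w)) :=
      fun a b => by simp [IsCrossedHom.augmVec_mul hDY]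
    obtain ⟨χ, hχ, hχp⟩ := IsCrossedHom.exists_descent (ρ := (1 : B →* ℚ)) hp hadd fun w hw => by
      have h1 : w ∈ Subgroup.normalClosure rels := by rw [← hker]; exact hw
      exact hadd.mem_of_mem_normalClosure (fun _ _ => rfl) ⊥ (fun r hr => hhu (Sum.inl ⟨r, hr⟩)) h1
    have hχadd : ∀ a b, χ (a * b) = χ a + χ b := fun a b => by simpa using hχ a b
    have hχ0 := eq_zero_of_H1_surjective φ hH1 χ hχadd fun a => by
      obtain ⟨w, rfl⟩ := hq a
      refine additive_eq_of_freeGroup (h := fun w => χ (φ (q w))) (h' := fun _ => 0)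
        (fun a b => by rw [map_mul, map_mul, hχadd]) (fun _ _ => (add_zero 0).symm)
        (fun x => ?_) w
      rw [← hψ, hχp]
      exact hhu (Sum.inr x)
    ext y
    have := hχp (FreeGroup.of y)
    rw [hχ0, hDY1, augmVec_single, _root_.map_one, Int.cast_one] at this
    simpa using this.symm
  obtain ⟨F, hF⟩ := exists_semilinear_apply_eq j hj (leftOre_of_strongRankCondition _)
    (fun y : Y => Finsupp.single y (1 : MonoidAlgebra ℤ Γ))
    (Finsupp.linearIndependent_single_one _ _) fun y => D (p (FreeGroup.of y))
  have hFD : ∀ w, F (DY w) = D (p w) :=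
    (hDY.map_semilinear F).eq_of_freeGroup (hD.comp p) fun y => by simp [hDY1, hF]
  have hspan : Submodule.span (MonoidAlgebra ℤ Γ) (Set.range u) ≤ LinearMap.ker F := by
    refine Submodule.span_le.2 ?_
    rintro _ ⟨r | x, rfl⟩
    · change F (DY r) = 0
      rw [hFD, hrp r r.2, hD.map_one]
    · change F (DY (ψ (FreeGroup.of x))) = 0
      rw [hFD, hψ, h0]
  obtain ⟨w, rfl⟩ := hp b
  rw [← hFD]
  obtain ⟨a, ha, haw⟩ := exists_smul_mem_span_of_augmVec_span hΓ u hu (DY w)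
  have h1 : F (a • DY w) = 0 := hspan haw
  rw [map_smulₛₗ, smul_eq_mul] at h1
  exact (mul_eq_zero.1 h1).resolve_left fun h => ha (hj (by rw [h, map_zero]))

end Presentation

/-! ### Ranks of modules over Ore domains through functionals -/

section RankFunctionals

theorem linearIndependent_smul_of_ne_zero {R M κ : Type*} [Ring R] [IsDomain R] [AddCommGroup M]
    [Module R M] {v : κ → M} (hv : LinearIndependent R v) {a : κ → R} (ha : ∀ k, a k ≠ 0) :
    LinearIndependent R fun k => a k • v k := by
  rw [linearIndependent_iff'] at hv ⊢
  intro s c hc k hk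
  simp only [smul_smul] at hc
  exact (mul_eq_zero.1 (hv s (fun k => c k * a k) hc k hk)).resolve_right (ha k)

/-- An independent family can be enlarged by `y` if no non-zero multiple of `y` lies in its span. -/
theorem linearIndependent_sumElim_of_smul_notMem {R M κ : Type*} [Ring R] [AddCommGroup M]
    [Module R M] {v : κ → M} (hv : LinearIndependent R v) {y : M}
    (hy : ∀ a : R, a ≠ 0 → a • y ∉ Submodule.span R (Set.range v)) :
    LinearIndependent R (Sum.elim v fun _ : Unit => y) := by
  refine hv.sum_type ?_ ?_
  · rw [Fintype.linearIndependent_iff]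
    intro c hc i
    by_contra hne
    refine hy (c i) hne ?_
    have : c i • y = 0 := by simpa using hc
    rw [this]
    exact zero_mem _
  · rw [Submodule.disjoint_def]
    intro z hz hz'
    rw [Set.range_const, Submodule.mem_span_singleton] at hz'
    obtain ⟨a, rfl⟩ := hz'
    by_cases ha : a = 0
    · rw [ha, zero_smul]
    · exact absurd hz (hy a ha)

theorem rank_le_of_smul_mem_span {R : Type*} {M κ : Type u} [Ring R] [IsDomain R]
    [StrongRankCondition R] [AddCommGroup M] [Module R M] {v : κ → M} (hv : LinearIndependent R v)
    (h : ∀ y, ∃ a : R, a ≠ 0 ∧ a • y ∈ Submodule.span R (Set.range v)) :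
    Module.rank R M ≤ Cardinal.mk κ := by
  rw [Module.rank_def]
  refine ciSup_le' fun s => ?_
  choose a ha hav using h
  have h1 := linearIndependent_smul_of_ne_zero s.2.linearIndependent (a := fun y : s.1 => a y)
    fun y => ha y
  refine linearIndependent_le_basis (Module.Basis.span hv) (fun y : s.1 => ⟨a y • y, hav y⟩) ?_
  exact LinearIndependent.of_comp (Submodule.span R (Set.range v)).subtype h1

/-- Modules over Ore domains `R` and `R'` contained in the same skew field `K` have the same rank if
restriction along an additive map identifies the `K`-valued functionals on them. -/
theorem rank_eq_of_restriction_bijective {R R' K : Type*} {M M' : Type u} [Ring R] [Ring R']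
    [IsDomain R] [IsDomain R'] [StrongRankCondition R] [StrongRankCondition R'] [DivisionRing K]
    [AddCommGroup M] [AddCommGroup M'] [Module R M] [Module R' M'] {i : R →+* K} {j : R' →+* K}
    (hi : Function.Injective i) (hj : Function.Injective j) (f : M → M')
    (hext : ∀ G : M →ₛₗ[i] K, ∃ F : M' →ₛₗ[j] K, ∀ m, F (f m) = G m)
    (hres : ∀ F : M' →ₛₗ[j] K, ∃ G : M →ₛₗ[i] K, ∀ m, F (f m) = G m)
    (huniq : ∀ F : M' →ₛₗ[j] K, (∀ m, F (f m) = 0) → ∀ y, F y = 0) :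
    Module.rank R M = Module.rank R' M' := by
  classical
  have hR := leftOre_of_strongRankCondition R
  have hR' := leftOre_of_strongRankCondition R'
  have hind : ∀ {κ : Type u} (v : κ → M), LinearIndependent R v →
      LinearIndependent R' fun k => f (v k) := by
    intro κ v hv
    rw [linearIndependent_iff]
    intro c hc
    ext k
    obtain ⟨G, hG⟩ := exists_semilinear_apply_eq i hi hR v hv fun k' => if k' = k then 1 else 0
    obtain ⟨F, hF⟩ := hext G
    have h1 := congrArg F hc
    rw [Finsupp.linearCombination_apply, Finsupp.sum, map_sum, map_zero] at h1
    simp only [map_smulₛₗ, hF, hG, smul_eq_mul, mul_ite, mul_one, mul_zero,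
      Finset.sum_ite_eq', Finsupp.mem_support_iff] at h1
    by_contra hne
    rw [if_pos (show c k ≠ 0 from hne)] at h1
    exact hne (hj (h1.trans (map_zero j).symm))
  -- The image of a maximal independent set `s` is maximal as well. Otherwise it could be enlarged
  -- by a vector `y`, and a functional on `M'` that vanishes on the image of `s` but not at `y`
  -- would restrict to zero on `M`, against uniqueness.
  obtain ⟨s, hs, hmax⟩ := exists_maximal_linearIndepOn R (id : M → M)
  rw [Set.image_id] at hmax
  refine le_antisymm ?_ ?_
  · rw [Module.rank_def]
    exact ciSup_le' fun t => (hind _ t.2.linearIndependent).cardinal_le_rank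
  · have h2 := hind (fun x : s => (x : M)) hs.linearIndependent
    refine (rank_le_of_smul_mem_span h2 fun y => ?_).trans hs.linearIndependent.cardinal_le_rank
    by_contra! hy
    have h3 := linearIndependent_sumElim_of_smul_notMem h2 hy
    obtain ⟨F, hF⟩ := exists_semilinear_apply_eq j hj hR' _ h3
      (Sum.elim (fun _ => 0) fun _ => 1)
    obtain ⟨G, hG⟩ := hres F
    have hGs : Submodule.span R s ≤ LinearMap.ker G := Submodule.span_le.2 fun x hx => by
      change G x = 0
      rw [← hG]
      exact hF (Sum.inl ⟨x, hx⟩)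
    have hG0 : ∀ x, G x = 0 := by
      intro x
      by_cases hx : x ∈ s
      · exact hGs (Submodule.subset_span hx)
      · obtain ⟨a, ha, hax⟩ := hmax x hx
        have h4 : G (a • x) = 0 := hGs hax
        rw [map_smulₛₗ, smul_eq_mul] at h4
        exact (mul_eq_zero.1 h4).resolve_left fun h => ha (hi (by rw [h, map_zero]))
    have h5 := huniq F (fun m => by rw [hG, hG0]) y
    have h6 := hF (Sum.inr ())
    exact one_ne_zero (h6.symm.trans h5)

end RankFunctionals

/-! ### Comparison of the torsion-free derived series -/

section Comparison

variable {A B : Type u} [Group A] [Group B]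

/-- If `φ` induces an injection `A/M → B/N`, then a skew field that contains `ℤ[B/N]` contains
`ℤ[A/M]` compatibly with the actions of `A` and `B`. -/
theorem exists_embedding_comp (φ : A →* B) (M : Subgroup A) (N : Subgroup B) [M.Normal] [N.Normal]
    (h : ∀ a, φ a ∈ N ↔ a ∈ M) {K : Type*} [DivisionRing K]
    {j : MonoidAlgebra ℤ (B ⧸ N) →+* K} (hj : Function.Injective j) :
    ∃ i : MonoidAlgebra ℤ (A ⧸ M) →+* K, Function.Injective i ∧
      quotAction M i = (quotAction N j).comp φ := by
  let κ : A ⧸ M →* B ⧸ N := QuotientGroup.map M N φ fun a ha => (h a).2 ha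
  have hκ : Function.Injective κ := by
    rw [injective_iff_map_eq_one]
    intro x hx
    obtain ⟨a, rfl⟩ := QuotientGroup.mk_surjective x
    rw [QuotientGroup.eq_one_iff, ← h]
    exact (QuotientGroup.eq_one_iff _).1 hx
  refine ⟨j.comp (MonoidAlgebra.mapDomainRingHom ℤ κ),
    hj.comp (MonoidAlgebra.mapDomain_injective hκ), ?_⟩
  ext a
  rw [quotAction_apply, MonoidHom.comp_apply, quotAction_apply, RingHom.comp_apply]
  congr 1
  exact MonoidAlgebra.mapDomain_single

variable [Group.FG A] (hB : FinitelyRelated B) (φ : A →* B) (n : ℕ)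
  (hH1 : Function.Injective (Hlgy.map ℚ φ 1))
  (hH2 : Function.Surjective ((PhiSpan (tfDerived B n)).mkQ ∘ₗ Hlgy.map ℚ φ 2))

include hB hH1 hH2 in
/-- The subgroup `B^{(n)}_H` of the hypothesis on `H_2` acts trivially on `K` for all `m ≤ n`. -/
theorem exists_extension_tfDerived {m : ℕ} (hm : m ≤ n) {K : Type*} [DivisionRing K]
    {j : MonoidAlgebra ℤ (B ⧸ tfDerived B m) →+* K} (hj : Function.Injective j) {D₀ : A → K}
    (hD₀ : IsCrossedHom ((quotAction (tfDerived B m) j).comp φ) D₀) :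
    ∃ D : B → K, IsCrossedHom (quotAction (tfDerived B m) j) D ∧ ∀ a, D (φ a) = D₀ a :=
  IsCrossedHom.exists_extension hB (augmentationDetects_tfDerived B m) φ (tfDerived B n) hH1 hH2
    (QuotientGroup.mk' (tfDerived B m))
    (fun x hx => (QuotientGroup.eq_one_iff x).2 (tfDerived_antitone B hm hx)) hj hD₀

include hB hH1 hH2 in
/-- `φ` induces injections of the quotients by the terms of the torsion-free derived series. -/
theorem map_mem_tfDerived_iff {m : ℕ} (hm : m ≤ n + 1) (a : A) :
    φ a ∈ tfDerived B m ↔ a ∈ tfDerived A m := by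
  induction m generalizing a with
  | zero => simp [tfDerived_zero]
  | succ m ih =>
    have ih' : ∀ a, φ a ∈ tfDerived B m ↔ a ∈ tfDerived A m := fun a => ih (by omega) a
    obtain ⟨K, _, j, hj⟩ := exists_divisionRing_embedding (MonoidAlgebra ℤ (B ⧸ tfDerived B m))
    obtain ⟨i, hi, hij⟩ := exists_embedding_comp φ (tfDerived A m) (tfDerived B m) ih' hj
    constructor
    · intro ha
      refine mem_torsionStep_of_forall (N := tfDerived A m) hi (leftOre_tfDerived A m)
        ((ih' a).1 (tfDerived_succ_le B m ha)) fun D₀ hD₀ => ?_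
      rw [hij] at hD₀
      obtain ⟨D, hD, hDφ⟩ := exists_extension_tfDerived hB φ n hH1 hH2 (by omega) hj hD₀
      rw [← hDφ]
      exact hD.eq_zero_of_mem_torsionStep hj ha
    · intro ha
      refine mem_torsionStep_of_forall (N := tfDerived B m) hj (leftOre_tfDerived B m)
        ((ih' a).2 (tfDerived_succ_le A m ha)) fun D hD => ?_
      have hD' := hD.comp φ
      rw [← hij] at hD'
      exact hD'.eq_zero_of_mem_torsionStep hi ha

/-- The rank of the right module agrees with the rank of the corresponding left module. -/
theorem tfDerivedRank_eq (G : Type u) [Group G] (n : ℕ) :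
    tfDerivedRank G n =
      Module.rank (MonoidAlgebra ℤ (G ⧸ tfDerived G n)) (tfDerivedQuot G n) :=
  (rank_eq_of_equiv_equiv (groupRingInv (G ⧸ tfDerived G n)) (AddEquiv.refl (tfDerivedQuot G n))
    (groupRingInv_bijective _) fun _ _ => rfl).symm

include hB hH1 hH2 in
/-- The functionals on the two modules are restrictions of crossed homomorphisms, which extend from
`A` to `B`. If the restriction to `A` is inner, then so is the crossed homomorphism on `B`, and the
functional is zero. -/
theorem tfDerivedRank_eq_of_H1_bijective (hb : Function.Bijective (Hlgy.map ℚ φ 1)) :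
    tfDerivedRank A n = tfDerivedRank B n := by
  have hφ := fun a => map_mem_tfDerived_iff hB φ n hH1 hH2 (Nat.le_succ n) a
  have hφ' := fun a => map_mem_tfDerived_iff hB φ n hH1 hH2 le_rfl a
  obtain ⟨K, _, j, hj⟩ := exists_divisionRing_embedding (MonoidAlgebra ℤ (B ⧸ tfDerived B n))
  obtain ⟨i, hi, hij⟩ := exists_embedding_comp φ (tfDerived A n) (tfDerived B n) hφ hj
  have hA := ConjQuot.mk_surjective _ _ (commutator_tfDerived_le A n)
  have hBs := ConjQuot.mk_surjective _ _ (commutator_tfDerived_le B n)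
  choose s hs using hA
  have key : ∀ (D : B → K), IsCrossedHom (quotAction (tfDerived B n) j) D →
      ∃ G : tfDerivedQuot A n →ₛₗ[i] K, ∀ x : tfDerived A n,
        G (tfDerivedQuot.mk A n x) = D (φ x) := by
    intro D hD
    have hD' := hD.comp φ
    rw [← hij] at hD'
    exact exists_semilinear_of_isCrossedHom _ _ hD' fun x _ hx =>
      hD'.eq_zero_of_mem_torsionStep hi hx
  rw [tfDerivedRank_eq, tfDerivedRank_eq]
  refine rank_eq_of_restriction_bijective hi hj
    (fun x => tfDerivedQuot.mk B n ⟨φ (s x), (hφ _).2 (s x).2⟩) (fun G => ?_) (fun F => ?_)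
    fun F hF y => ?_
  · obtain ⟨D₀, hD₀, hD₀G⟩ := exists_isCrossedHom_of_semilinear _ _ hi (leftOre_tfDerived A n) G
    rw [hij] at hD₀
    obtain ⟨D, hD, hDφ⟩ := exists_extension_tfDerived hB φ n hH1 hH2 le_rfl hj hD₀
    obtain ⟨F, hF⟩ := exists_semilinear_of_isCrossedHom _ (commutator_tfDerived_le B n) hD
      fun x _ hx => hD.eq_zero_of_mem_torsionStep hj hx
    refine ⟨F, fun x => ?_⟩
    rw [hF, hDφ, hD₀G, hs]
  · obtain ⟨D, hD, hDF⟩ := exists_isCrossedHom_of_semilinear _ _ hj (leftOre_tfDerived B n) F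
    obtain ⟨G, hG⟩ := key D hD
    refine ⟨G, fun x => ?_⟩
    rw [← hDF, ← hs x, hG, hs]
  · obtain ⟨D, hD, hDF⟩ := exists_isCrossedHom_of_semilinear _ _ hj (leftOre_tfDerived B n) F
    obtain ⟨G, hG⟩ := key D hD
    have hD' := hD.comp φ
    have hDA : ∀ a ∈ tfDerived A n, D (φ a) = 0 := by
      intro a ha
      rw [← hG ⟨a, ha⟩, ← hs (tfDerivedQuot.mk A n ⟨a, ha⟩), hG, ← hF, ← hDF]
    rw [← hij] at hD'
    obtain ⟨k, hk⟩ := hD'.exists_inner hi (leftOre_tfDerived A n) hDA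
    have h0 := IsCrossedHom.eq_zero_of_comp_eq_zero hB (augmentationDetects_tfDerived B n) φ hb.2
      (QuotientGroup.mk' (tfDerived B n)) hj (hD.sub (IsCrossedHom.inner _ k)) fun a => by
        have := hk a
        rw [hij] at this
        exact sub_eq_zero.2 this
    obtain ⟨x, rfl⟩ := hBs y
    rw [← hDF, sub_eq_zero.1 (h0 x), quotAction_eq_one _ _ x.2, one_smul, sub_self]

end Comparison

theorem theorem2p1 {A B : Type u} [Group A] [Group B] [Group.FG A] (hB : FinitelyRelated B)
    (φ : A →* B) (n : ℕ)
    (hH1 : Function.Injective (Hlgy.map ℚ φ 1))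
    (hH2 : Function.Surjective
      ((PhiSpan (tfDerived B n)).mkQ ∘ₗ Hlgy.map ℚ φ 2)) :
    (∀ m ≤ n + 1, ∃ f : A ⧸ tfDerived A m →* B ⧸ tfDerived B m,
      (∀ a : A, f (a : A ⧸ tfDerived A m) = (φ a : B ⧸ tfDerived B m)) ∧
        Function.Injective f) ∧
    (Function.Bijective (Hlgy.map ℚ φ 1) →
      (∃ (hφ : ∀ x ∈ tfDerived A n, φ x ∈ tfDerived B n)
          (f : tfDerivedQuot A n →+ tfDerivedQuot B n),
        (∀ x : tfDerived A n,
          f (tfDerivedQuot.mk A n x) = tfDerivedQuot.mk B n ⟨φ x, hφ x x.2⟩) ∧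
        Function.Injective f) ∧
      tfDerivedRank A n = tfDerivedRank B n) := by
  have key : ∀ m ≤ n + 1, ∀ a, φ a ∈ tfDerived B m ↔ a ∈ tfDerived A m :=
    fun m hm a => map_mem_tfDerived_iff hB φ n hH1 hH2 hm a
  refine ⟨fun m hm => ⟨QuotientGroup.map _ _ φ fun a ha => (key m hm a).2 ha, fun _ => rfl, ?_⟩,
    fun hb => ⟨⟨fun x hx => (key n (Nat.le_succ n) x).2 hx, ?_⟩,
      tfDerivedRank_eq_of_H1_bijective hB φ n hH1 hH2 hb⟩⟩
  · rw [injective_iff_map_eq_one]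
    intro x hx
    obtain ⟨a, rfl⟩ := QuotientGroup.mk_surjective x
    rw [QuotientGroup.eq_one_iff, ← key m hm]
    exact (QuotientGroup.eq_one_iff _).1 hx
  · let ψ : tfDerived A n →* tfDerived B n := (φ.comp (tfDerived A n).subtype).codRestrict
      (tfDerived B n) fun x => (key n (Nat.le_succ n) x).2 x.2
    let f : tfDerivedQuot A n →+ tfDerivedQuot B n := MonoidHom.toAdditive
      (QuotientGroup.map ((tfDerived A (n + 1)).subgroupOf _) ((tfDerived B (n + 1)).subgroupOf _) ψ
        fun x hx => Subgroup.mem_comap.2 (Subgroup.mem_subgroupOf.2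
          ((key (n + 1) le_rfl x).2 (Subgroup.mem_subgroupOf.1 hx))))
    refine ⟨f, fun x => rfl, (injective_iff_map_eq_zero f).2 fun y hy => ?_⟩
    obtain ⟨x, rfl⟩ := ConjQuot.mk_surjective _ _ (commutator_tfDerived_le A n) y
    exact (ConjQuot.mk_eq_zero_iff _ _ _ x).2 ((key (n + 1) le_rfl x).1
      ((ConjQuot.mk_eq_zero_iff _ _ (commutator_tfDerived_le B n) (ψ x)).1 hy))
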